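/- Let $M, N_1, N_2$ be the dimensions of an input and of two outputs, and consider the two channels $$\mathbf{Y} = \mathbf{A}\mathbf{X} + \mathbf{n}_1, \qquad \mathbf{Z} = \mathbf{B}\mathbf{X} + \mathbf{n}_2,$$ where $\mathbf{X}$ is a random vector in $\mathbb{C}^M$, $\mathbf{A}$ ($N_1\times M$) and $\mathbf{B}$ ($N_2\times M$) are random complex matrices, and $\mathbf{n}_1 \sim \mathcal{CN}(0,\Sigma_1)$, $\mathbf{n}_2 \sim \mathcal{CN}(0,\Sigma_2)$ are circularly symmetric complex Gaussian noise vectors with positive definite covariance matrices. Assume that $\mathbf{X}$, $(\mathbf{A},\mathbf{B})$, $\mathbf{n}_1$, $\mathbf{n}_2$ are mutually independent, that $\mathbf{G}=\begin{bmatrix}\mathbf{A}\\ \mathbf{B}\end{bmatrix}$ is isotropic, i.e. $\mathbf{G}Q$ has the same law as $\mathbf{G}$ for every deterministic unitary $M\times M$ matrix $Q$, and that $\mathbb{E}\|\mathbf{X}\|^2 \le \gamma$, where $\gamma\ge 0$. Let $\mathbf{X}_G \sim \mathcal{CN}(0, \frac{\gamma}{M} I_M)$ be independent of $(\mathbf{A},\mathbf{B},\mathbf{n}_1,\mathbf{n}_2)$,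 and let $\mathbf{Y}_G, \mathbf{Z}_G$ be the outputs with input $\mathbf{X}_G$. Mutual information is measured in bits and may be $+\infty$. Then: 1. $I(\mathbf{Y};\mathbf{X}\mid\mathbf{Z},\mathbf{A},\mathbf{B}) \le I(\mathbf{Y}_G;\mathbf{X}_G\mid\mathbf{Z}_G,\mathbf{A},\mathbf{B})$. 2. Put $$J=\log_2\det\left(\begin{bmatrix}\Sigma_1&0\\0&\Sigma_2\end{bmatrix}+\frac{\gamma}{M}\begin{bmatrix}\mathbf{A}\\ \mathbf{B}\end{bmatrix}\begin{bmatrix}\mathbf{A}^\dagger&\mathbf{B}^\dagger\end{bmatrix}\right),\qquad L=\log_2\left(\det\left(\Sigma_2+\frac{\gamma}{M}\mathbf{B}\mathbf{B}^\dagger\right)\det\Sigma_1\right).$$ If $L$ is integrable, then $I(\mathbf{Y}_G;\mathbf{X}_G\mid\mathbf{Z}_G,\mathbf{A},\mathbf{B}) = \mathbb{E}J-\mathbb{E}L$, both sides being $+\infty$ when $J$ is not integrable. If $\mathbb{E}\|\mathbf{A}\|^2<\infty$ and $\mathbb{E}\|\mathbf{B}\|^2<\infty$, then $J$ and $L$ are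 integrable. 3. For every $n$, let $\mathbf{X}^n=(\mathbf{X}[1],\dots,\mathbf{X}[n])$ be any random sequence in $\mathbb{C}^M$ with $\frac1n\sum_{i=1}^n\mathbb{E}\|\mathbf{X}[i]\|^2\le\gamma$, and suppose that, conditioned on $\mathbf{X}^n = x^n$, the tuples $(\mathbf{Y}[i],\mathbf{Z}[i],\mathbf{A}[i],\mathbf{B}[i])$, $i=1,\dots,n$, are independent, the $i$-th one having the law of $(\mathbf{A}x[i]+\mathbf{n}_1,\ \mathbf{B}x[i]+\mathbf{n}_2,\ \mathbf{A},\ \mathbf{B})$, which is the conditional law of $(\mathbf{Y},\mathbf{Z},\mathbf{A},\mathbf{B})$ given $\mathbf{X}=x[i]$. Then $$I(\mathbf{Y}^n;\mathbf{X}^n\mid\mathbf{Z}^n,\mathbf{A}^n,\mathbf{B}^n)\le n\, I(\mathbf{Y}_G;\mathbf{X}_G\mid\mathbf{Z}_G,\mathbf{A},\mathbf{B}).$$ -/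

import Mathlib

open MeasureTheory ProbabilityTheory
open scoped ENNReal Matrix ComplexOrder MatrixOrder

universe u v

/-- Complex matrices carry the Borel (product) sigma-algebra of their entries. -/
noncomputable instance matrixMeasurableSpace {m n : Type*} : MeasurableSpace (Matrix m n ℂ) :=
  inferInstanceAs (MeasurableSpace (m → n → ℂ))

instance matrixStandardBorelSpace {m n : Type*} [Countable m] [Countable n] :
    StandardBorelSpace (Matrix m n ℂ) :=
  inferInstanceAs (StandardBorelSpace (m → n → ℂ))

instance funStandardBorelSpace {ι α : Type*} [Countable ι] [MeasurableSpace α]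
    [StandardBorelSpace α] : StandardBorelSpace (ι → α) :=
  StandardBorelSpace.pi_countable

/-- The law `CN(0, 1)` on `ℂ`: independent real and imaginary parts, each of law `N(0, 1/2)`. -/
noncomputable def stdComplexGaussian : Measure ℂ :=
  ((gaussianReal 0 2⁻¹).prod (gaussianReal 0 2⁻¹)).map (fun p : ℝ × ℝ => Complex.mk p.1 p.2)

/-- The circularly symmetric complex Gaussian law `CN(0, S)` on `ℂ^N`, for `S` Hermitian positive
semidefinite: the law of `S^{1/2} w`, where the entries of `w` are i.i.d. `CN(0, 1)`. -/
noncomputable def complexGaussian {N : ℕ} (S : Matrix (Fin N) (Fin N) ℂ) :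
    Measure (Fin N → ℂ) :=
  (Measure.pi (fun _ : Fin N => stdComplexGaussian)).map
    (fun w => CFC.sqrt S *ᵥ w)

/-- A random matrix `G` is isotropic if `G Q` has the same law as `G` for every deterministic
unitary matrix `Q`. -/
def IsIsotropic {Ω : Type*} [MeasurableSpace Ω] (μ : Measure Ω) {ι : Type*} {M : ℕ}
    (G : Ω → Matrix ι (Fin M) ℂ) : Prop :=
  ∀ Q ∈ Matrix.unitaryGroup (Fin M) ℂ, IdentDistrib (fun ω => G ω * Q) G μ μ

/-- The conditional mutual information `I(U; X | V)` in bits: the Kullback-Leibler divergence of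
the joint law of `(V, U, X)` from the law under which, given `V`, the variables `U` and `X` are
conditionally independent with their original conditional laws. The value may be `∞`. -/
noncomputable def condMutualInfo {Ω α β γ : Type*} [MeasurableSpace Ω]
    [MeasurableSpace α] [StandardBorelSpace α] [Nonempty α]
    [MeasurableSpace β] [StandardBorelSpace β] [Nonempty β] [MeasurableSpace γ]
    (μ : Measure Ω) [IsFiniteMeasure μ] (U : Ω → α) (X : Ω → β) (V : Ω → γ) : ℝ≥0∞ :=
  InformationTheory.klDiv (μ.map (fun ω => (V ω, U ω, X ω)))
    ((μ.map V) ⊗ₘ (condDistrib U V μ ×ₖ condDistrib X V μ)) / ENNReal.ofReal (Real.log 2)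

/-- The output `A x + n` of a linear fading channel with random input `x`. -/
def channelOutput {Ω : Type*} {N M : ℕ} (A : Ω → Matrix (Fin N) (Fin M) ℂ)
    (x : Ω → Fin M → ℂ) (n : Ω → Fin N → ℂ) : Ω → Fin N → ℂ :=
  fun ω => A ω *ᵥ x ω + n ω

/-- The law of `(A x + n₁, B x + n₂, A, B)` for the deterministic input `x`. When the input `X` is
independent of the fading and the noise, it is the conditional law of `(Y, Z, A, B)` given
`X = x`. -/
noncomputable def channelLaw {Ω : Type*} [MeasurableSpace Ω] (μ : Measure Ω) {M N₁ N₂ : ℕ}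
    (A : Ω → Matrix (Fin N₁) (Fin M) ℂ) (B : Ω → Matrix (Fin N₂) (Fin M) ℂ)
    (n₁ : Ω → Fin N₁ → ℂ) (n₂ : Ω → Fin N₂ → ℂ) (x : Fin M → ℂ) :
    Measure ((Fin N₁ → ℂ) × (Fin N₂ → ℂ) ×
      Matrix (Fin N₁) (Fin M) ℂ × Matrix (Fin N₂) (Fin M) ℂ) :=
  μ.map (fun ω => (A ω *ᵥ x + n₁ ω, B ω *ᵥ x + n₂ ω, A ω, B ω))

/-- `log₂ det (diag(S₁, S₂) + ρ [A; B] [Aᴴ Bᴴ])`. -/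
noncomputable def logDetJoint {M N₁ N₂ : ℕ} (S₁ : Matrix (Fin N₁) (Fin N₁) ℂ)
    (S₂ : Matrix (Fin N₂) (Fin N₂) ℂ) (ρ : ℝ)
    (A : Matrix (Fin N₁) (Fin M) ℂ) (B : Matrix (Fin N₂) (Fin M) ℂ) : ℝ :=
  Real.logb 2 (Matrix.det (Matrix.fromBlocks S₁ 0 0 S₂ +
    (ρ : ℂ) • (Matrix.fromRows A B * Matrix.fromCols Aᴴ Bᴴ))).re

/-- `log₂ (det (S₂ + ρ B Bᴴ) · det S₁)`. -/
noncomputable def logDetSide {M N₁ N₂ : ℕ} (S₁ : Matrix (Fin N₁) (Fin N₁) ℂ)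
    (S₂ : Matrix (Fin N₂) (Fin N₂) ℂ) (ρ : ℝ) (B : Matrix (Fin N₂) (Fin M) ℂ) : ℝ :=
  Real.logb 2 (Matrix.det (S₂ + (ρ : ℂ) • (B * Bᴴ)) * Matrix.det S₁).re

/-! The proof never subtracts differential entropies; it compares conditional output laws with one
reference kernel. For any Markov kernel `Q` from the side information `V = (Z, A, B)` to the first
output, the golden formula `klDiv_condIndep_add` says that `I(Y; X | V)` plus the divergence of the
law of `(V, Y)` from the one generated by `Q` equals the mean divergence of the law of `Y` given
`(V, X)` from `Q`. All terms lie in `[0, ∞]`, so no finiteness is needed: dropping the output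
divergence gives an upper bound for every input, and equality holds when `Q` is the true conditional
law of `Y` given `V`.

Take for `Q` the conditional law under the Gaussian input. By linear estimation
(`map_observation_error_eq_prod`) it is Gaussian, with mean `T z` for the LMMSE matrix `T` and
covariance the error covariance `C`. For a deterministic input `x` the mean divergence from `Q` is
then a constant plus a quadratic form in `x` (`lintegral_klDiv_observation`). `C` and `T` depend on
the fading only through Gram products, so they do not change when both fading matrices are
multiplied by a unitary; isotropy therefore makes the averaged quadratic form unitarily invariant,
hence a multiple of the squared norm (`IsIsotropic.exists_lintegral_inputDivergence`). The upper
bound thus becomes `c + φ E‖X‖²`, which is at most `c + φ P`, the exact value for the Gaussian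
input.

For `n` uses the reference is the product kernel. Given the input sequence, divergences of products
add, so only the total power enters, whatever the dependence among the inputs. The value follows by
averaging over the Gaussian input: the traces cancel
(`baseDivergence_add_lintegral_inputDivergence`), leaving `log det C - log det S₁`, and the Schur
complement (`det_joint_eq`) turns this into the difference of the two log-determinants. -/

/-! ### Divergence of composition-products and of products. -/

section KullbackLeibler

open InformationTheory

variable {α β γ : Type*} [MeasurableSpace α] [MeasurableSpace β] [MeasurableSpace γ]

/-- Data processing, applied to the map and to its inverse. -/
theorem klDiv_map_equiv (μ ν : Measure α) [IsFiniteMeasure μ] [IsFiniteMeasure ν] (e : α ≃ᵐ β) :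
    klDiv (μ.map e) (ν.map e) = klDiv μ ν := by
  refine le_antisymm (klDiv_map_le μ ν e.measurable) ?_
  have h := klDiv_map_le (μ.map e) (ν.map e) e.symm.measurable
  rwa [e.map_symm_map, e.map_symm_map] at h

/-- The conditional form of the divergence of two composition-products with the same base. -/
theorem klDiv_compProd_right [StandardBorelSpace β] (m : Measure α) [IsFiniteMeasure m]
    (κ η : Kernel α β) [IsMarkovKernel κ] [IsMarkovKernel η] (hac : ∀ a, κ a ≪ η a) :
    klDiv (m ⊗ₘ κ) (m ⊗ₘ η) = ∫⁻ a, klDiv (κ a) (η a) ∂m := by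
  have hac' : m ⊗ₘ κ ≪ m ⊗ₘ η :=
    Measure.AbsolutelyContinuous.compProd_right (Filter.Eventually.of_forall hac)
  have hf : Measurable fun p : α × β => κ.rnDeriv η p.1 p.2 := Kernel.measurable_rnDeriv κ η
  -- The kernel derivative is a jointly measurable density, which links the derivative of the
  -- composition-products to the fibrewise derivatives.
  have hdens : m ⊗ₘ κ = (m ⊗ₘ η).withDensity fun p => κ.rnDeriv η p.1 p.2 := by
    ext s hs
    rw [withDensity_apply _ hs, ← lintegral_indicator hs, Measure.lintegral_compProd
      (hf.indicator hs), Measure.compProd_apply hs]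
    refine lintegral_congr fun a => ?_
    have hs' : MeasurableSet (Prod.mk a ⁻¹' s) := measurable_prodMk_left hs
    have h : (κ a) (Prod.mk a ⁻¹' s) = (η.withDensity (κ.rnDeriv η)) a (Prod.mk a ⁻¹' s) := by
      rw [Kernel.withDensity_rnDeriv_eq (hac a)]
    rw [h, Kernel.withDensity_apply' _ hf, ← lintegral_indicator hs']
    rfl
  rw [klDiv_eq_lintegral_klFun_of_ac hac']
  have h1 : (m ⊗ₘ κ).rnDeriv (m ⊗ₘ η) =ᵐ[m ⊗ₘ η] fun p => κ.rnDeriv η p.1 p.2 := by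
    rw [hdens]; exact Measure.rnDeriv_withDensity _ hf
  rw [lintegral_congr_ae (h1.mono fun p hp => by rw [hp]), Measure.lintegral_compProd
    (by have := measurable_klFun; fun_prop)]
  refine lintegral_congr fun a => ?_
  rw [klDiv_eq_lintegral_klFun_of_ac (hac a)]
  refine lintegral_congr_ae ?_
  filter_upwards [Kernel.rnDeriv_eq_rnDeriv_measure (κ := κ) (η := η) (a := a)] with y hy
  rw [hy]

/-- The chain rule with constant kernels; after a swap, the term with a common first factor is again
a divergence of composition-products over one kernel. -/
theorem klDiv_prod (μ₁ ν₁ : Measure α) (μ₂ ν₂ : Measure β) [IsProbabilityMeasure μ₁]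
    [IsProbabilityMeasure ν₁] [IsProbabilityMeasure μ₂] [IsProbabilityMeasure ν₂] :
    klDiv (μ₁.prod μ₂) (ν₁.prod ν₂) = klDiv μ₁ ν₁ + klDiv μ₂ ν₂ := by
  have h := klDiv_compProd_eq_add μ₁ ν₁ (Kernel.const α μ₂) (Kernel.const α ν₂)
  simp only [Measure.compProd_const] at h
  rw [h]
  congr 1
  rw [← klDiv_map_equiv _ _ (MeasurableEquiv.prodComm (α := α) (β := β))]
  have h' := klDiv_compProd_left μ₂ ν₂ (Kernel.const β μ₁)
  simp only [Measure.compProd_const] at h'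
  rw [← h']
  congr 1 <;> exact Measure.prod_swap

theorem klDiv_pi {n : ℕ} (μ ν : Fin n → Measure α) [∀ i, IsProbabilityMeasure (μ i)]
    [∀ i, IsProbabilityMeasure (ν i)] :
    klDiv (Measure.pi μ) (Measure.pi ν) = ∑ i, klDiv (μ i) (ν i) := by
  induction n with
  | zero =>
    rw [Measure.pi_of_empty, Measure.pi_of_empty]
    simp
  | succ n ih =>
    rw [← klDiv_map_equiv _ _ (MeasurableEquiv.piFinSuccAbove (fun _ => α) 0),
      (measurePreserving_piFinSuccAbove μ 0).map_eq, (measurePreserving_piFinSuccAbove ν 0).map_eq,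
      klDiv_prod, ih, Fin.sum_univ_succ]
    simp

/-- Drawing the last coordinate without looking at the middle one is conditional independence. This
puts the reference law of `condMutualInfo` into the form that the chain rule needs. -/
theorem map_compProd_prodMkRight (m : Measure α) [SFinite m] (κ : Kernel α β) (η : Kernel α γ)
    [IsSFiniteKernel κ] [IsSFiniteKernel η] :
    ((m ⊗ₘ κ) ⊗ₘ η.prodMkRight β).map (MeasurableEquiv.prodAssoc : (α × β) × γ ≃ᵐ α × β × γ) =
      m ⊗ₘ (κ ×ₖ η) := by
  refine Measure.ext_of_lintegral _ fun f hf => ?_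
  have hf' : Measurable fun p : (α × β) × γ => f (MeasurableEquiv.prodAssoc p) := by fun_prop
  rw [lintegral_map hf (by fun_prop), Measure.lintegral_compProd hf',
    Measure.lintegral_compProd hf'.lintegral_kernel_prod_right', Measure.lintegral_compProd hf]
  refine lintegral_congr fun a => ?_
  rw [Kernel.lintegral_prod _ _ _ (by fun_prop)]
  rfl

end KullbackLeibler

/-! ### The golden formula and its two consequences. -/

section CondMutualInfo

open InformationTheory

variable {Ω α β γ : Type*} [MeasurableSpace Ω] [MeasurableSpace α] [StandardBorelSpace α]
  [Nonempty α] [MeasurableSpace β] [StandardBorelSpace β] [Nonempty β] [MeasurableSpace γ]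
  {μ : Measure Ω} [IsProbabilityMeasure μ] {U : Ω → α} {X : Ω → β} {V : Ω → γ}

/-- The golden formula: replacing the conditional law of the output by any kernel `Q` costs the
divergence of the output law from the law produced by `Q`. -/
theorem klDiv_condIndep_add (hU : AEMeasurable U μ) (hX : AEMeasurable X μ)
    (hV : AEMeasurable V μ) (Q : Kernel γ α) [IsMarkovKernel Q] :
    klDiv (μ.map fun ω => (V ω, U ω)) (μ.map V ⊗ₘ Q) +
      klDiv (μ.map fun ω => (V ω, U ω, X ω))
        ((μ.map V) ⊗ₘ (condDistrib U V μ ×ₖ condDistrib X V μ)) =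
      klDiv (μ.map fun ω => ((V ω, X ω), U ω))
        ((μ.map fun ω => (V ω, X ω)) ⊗ₘ Q.prodMkRight β) := by
  have hVp : IsProbabilityMeasure (μ.map V) := Measure.isProbabilityMeasure_map hV
  have hVU : AEMeasurable (fun ω => (V ω, U ω)) μ := hV.prodMk hU
  have hVX : AEMeasurable (fun ω => (V ω, X ω)) μ := hV.prodMk hX
  have := Measure.isProbabilityMeasure_map hVU
  have := Measure.isProbabilityMeasure_map hVX
  have := Measure.isProbabilityMeasure_map (hVX.prodMk hU)
  have := Measure.isProbabilityMeasure_map (hVU.prodMk hX)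
  -- The chain rule splits off `(V, U)`, with a reference law drawing `U` from `Q` and `X` from its
  -- law given `V`. The second term is the conditional mutual information (`h1`); regrouping the
  -- joint divergence as `((V, X), U)` gives the right-hand side.
  have h := klDiv_compProd_eq_add (μ.map fun ω => (V ω, U ω)) (μ.map V ⊗ₘ Q)
    (condDistrib X (fun ω => (V ω, U ω)) μ) ((condDistrib X V μ).prodMkRight α)
  rw [compProd_map_condDistrib hX] at h
  have h1 : klDiv (μ.map fun ω => ((V ω, U ω), X ω))
      ((μ.map fun ω => (V ω, U ω)) ⊗ₘ (condDistrib X V μ).prodMkRight α) =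
      klDiv (μ.map fun ω => (V ω, U ω, X ω))
        ((μ.map V) ⊗ₘ (condDistrib U V μ ×ₖ condDistrib X V μ)) := by
    rw [← klDiv_map_equiv _ _ MeasurableEquiv.prodAssoc, ← compProd_map_condDistrib hU,
      map_compProd_prodMkRight, AEMeasurable.map_map_of_aemeasurable (by fun_prop)
      (hVU.prodMk hX)]
    rfl
  rw [← h1, ← h]
  let e : (γ × α) × β ≃ᵐ (γ × β) × α :=
    (MeasurableEquiv.prodAssoc.trans
      ((MeasurableEquiv.refl γ).prodCongr MeasurableEquiv.prodComm)).trans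
      MeasurableEquiv.prodAssoc.symm
  rw [← klDiv_map_equiv _ _ e]
  congr 1
  · rw [AEMeasurable.map_map_of_aemeasurable (by fun_prop) (hVU.prodMk hX)]
    rfl
  · rw [← compProd_map_condDistrib hX]
    -- Given `V`, both reference laws are the product of `Q` and the law of `X`, so they differ only
    -- by the order of integration.
    refine Measure.ext_of_lintegral _ fun f hf => ?_
    rw [lintegral_map hf (by fun_prop)]
    have e1 := map_compProd_prodMkRight (μ.map V) Q (condDistrib X V μ)
    have e2 := map_compProd_prodMkRight (μ.map V) (condDistrib X V μ) Q
    have h2 : ∫⁻ p, f (e p) ∂((μ.map V ⊗ₘ Q) ⊗ₘ (condDistrib X V μ).prodMkRight α) =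
        ∫⁻ q, f ((q.1, q.2.2), q.2.1) ∂(μ.map V ⊗ₘ (Q ×ₖ condDistrib X V μ)) := by
      rw [← e1, lintegral_map (by fun_prop) (by fun_prop)]; rfl
    have h3 : ∫⁻ p, f p ∂((μ.map V ⊗ₘ condDistrib X V μ) ⊗ₘ Q.prodMkRight β) =
        ∫⁻ q, f ((q.1, q.2.1), q.2.2) ∂(μ.map V ⊗ₘ (condDistrib X V μ ×ₖ Q)) := by
      rw [← e2, lintegral_map (by fun_prop) (by fun_prop)]; rfl
    rw [h2, h3, Measure.lintegral_compProd (by fun_prop), Measure.lintegral_compProd (by fun_prop)]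
    refine lintegral_congr fun a => ?_
    rw [Kernel.lintegral_prod_symm _ _ _ (by fun_prop), Kernel.lintegral_prod _ _ _ (by fun_prop)]

/-- The nonnegative output divergence in the golden formula is dropped. -/
theorem condMutualInfo_le_lintegral (hU : AEMeasurable U μ) (hX : AEMeasurable X μ)
    (hV : AEMeasurable V μ) (Q : Kernel γ α) [IsMarkovKernel Q] (κ : Kernel (γ × β) α)
    [IsMarkovKernel κ]
    (hκ : (μ.map fun ω => ((V ω, X ω), U ω)) = (μ.map fun ω => (V ω, X ω)) ⊗ₘ κ)
    (hac : ∀ p, κ p ≪ Q p.1) :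
    condMutualInfo μ U X V ≤
      (∫⁻ p, klDiv (κ p) (Q p.1) ∂(μ.map fun ω => (V ω, X ω))) / ENNReal.ofReal (Real.log 2) := by
  have := Measure.isProbabilityMeasure_map (hV.prodMk hX)
  unfold condMutualInfo
  gcongr
  have h := klDiv_condIndep_add hU hX hV Q
  rw [hκ, klDiv_compProd_right _ _ _ (fun a => hac a)] at h
  exact le_add_self.trans h.le

/-- By `hQ` the output divergence compares a law with itself, so nothing is lost. -/
theorem condMutualInfo_eq_lintegral (hU : AEMeasurable U μ) (hX : AEMeasurable X μ)
    (hV : AEMeasurable V μ) (Q : Kernel γ α) [IsMarkovKernel Q] (κ : Kernel (γ × β) α)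
    [IsMarkovKernel κ]
    (hκ : (μ.map fun ω => ((V ω, X ω), U ω)) = (μ.map fun ω => (V ω, X ω)) ⊗ₘ κ)
    (hac : ∀ p, κ p ≪ Q p.1)
    (hQ : (μ.map fun ω => (V ω, U ω)) = μ.map V ⊗ₘ Q) :
    condMutualInfo μ U X V =
      (∫⁻ p, klDiv (κ p) (Q p.1) ∂(μ.map fun ω => (V ω, X ω))) / ENNReal.ofReal (Real.log 2) := by
  have := Measure.isProbabilityMeasure_map (hV.prodMk hX)
  have := Measure.isProbabilityMeasure_map hV
  unfold condMutualInfo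
  congr 1
  have h := klDiv_condIndep_add hU hX hV Q
  rw [hκ, klDiv_compProd_right _ _ _ (fun a => hac a), hQ, klDiv_self, zero_add] at h
  exact h

end CondMutualInfo

/-! ### Products of kernels over finitely many channel uses. -/

section PiKernel

variable {ι α β γ : Type*} [Fintype ι] [MeasurableSpace α] [MeasurableSpace β]

/-- The product of a kernel over finitely many coordinates. -/
noncomputable def piKernel (ι : Type*) [Fintype ι] (κ : Kernel α β) [IsMarkovKernel κ] :
    Kernel (ι → α) (ι → β) where
  toFun a := Measure.pi fun i => κ (a i)
  measurable' := by
    refine Measurable.measure_of_isPiSystem_of_isProbabilityMeasure generateFrom_pi.symm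
      isPiSystem_pi ?_
    rintro _ ⟨s, hs, rfl⟩
    simp only [Measure.pi_pi]
    refine Finset.measurable_prod _ fun i _ => ?_
    exact (Kernel.measurable_coe κ (hs i (Set.mem_univ i))).comp (measurable_pi_apply i)

theorem piKernel_apply (κ : Kernel α β) [IsMarkovKernel κ] (a : ι → α) :
    piKernel ι κ a = Measure.pi fun i => κ (a i) := rfl

instance (κ : Kernel α β) [IsMarkovKernel κ] : IsMarkovKernel (piKernel ι κ) :=
  ⟨fun a => by rw [piKernel_apply]; infer_instance⟩

/-- The product of composition-products is the composition-product of the products. -/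
theorem pi_compProd {n : ℕ} (m : Fin n → Measure α) [∀ i, IsProbabilityMeasure (m i)]
    (κ : Fin n → Kernel α β)
    [∀ i, IsMarkovKernel (κ i)] (K : Kernel (Fin n → α) (Fin n → β)) [IsMarkovKernel K]
    (hK : ∀ v, K v = Measure.pi fun i => κ i (v i)) :
    Measure.pi (fun i => m i ⊗ₘ κ i) =
      (Measure.pi m ⊗ₘ K).map fun p i => (p.1 i, p.2 i) := by
  refine Measure.pi_eq fun s hs => ?_
  have hm : Measurable fun (p : (Fin n → α) × (Fin n → β)) (i : Fin n) => (p.1 i, p.2 i) := by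
    fun_prop
  rw [Measure.map_apply hm (.univ_pi hs), Measure.compProd_apply (hm (.univ_pi hs))]
  have h1 : ∀ v : Fin n → α, (K v) (Prod.mk v ⁻¹'
      ((fun (p : (Fin n → α) × (Fin n → β)) (i : Fin n) => (p.1 i, p.2 i)) ⁻¹' Set.univ.pi s)) =
      ∏ i, κ i (v i) (Prod.mk (v i) ⁻¹' s i) := by
    intro v
    rw [hK, ← Measure.pi_pi]
    congr 1
  simp_rw [h1]
  have hmeas : ∀ i, Measurable fun a => κ i a (Prod.mk a ⁻¹' s i) := fun i =>
    Kernel.measurable_kernel_prodMk_left (hs i)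
  -- Each factor depends on its own coordinate, so the integral of the product over `Measure.pi m`
  -- factors.
  have hind : iIndepFun (fun (i : Fin n) (v : Fin n → α) => κ i (v i) (Prod.mk (v i) ⁻¹' s i))
      (Measure.pi m) :=
    iIndepFun_pi (μ := m) (X := fun i a => κ i a (Prod.mk a ⁻¹' s i))
      fun i => (hmeas i).aemeasurable
  rw [lintegral_prod_eq_prod_lintegral_of_indepFun Finset.univ _ hind
    (fun i => (hmeas i).comp (measurable_pi_apply i))]
  refine Finset.prod_congr rfl fun i _ => ?_
  rw [Measure.compProd_apply (hs i)]
  exact (MeasureTheory.measurePreserving_eval (μ := m) i).lintegral_comp (hmeas i)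

end PiKernel

/-! ### Densities of finite product measures. -/

section PiDensity

variable {α : Type*} [MeasurableSpace α]

theorem lintegral_pi_prod {n : ℕ} (μ : Fin n → Measure α) [∀ i, SigmaFinite (μ i)]
    {f : Fin n → α → ℝ≥0∞} (hf : ∀ i, Measurable (f i)) :
    ∫⁻ x, ∏ i, f i (x i) ∂(Measure.pi μ) = ∏ i, ∫⁻ x, f i x ∂(μ i) := by
  induction n with
  | zero => rw [Measure.pi_of_empty]; simp
  | succ n ih =>
    rw [((measurePreserving_piFinSuccAbove μ 0).symm).lintegral_map_equiv]
    simp only [Fin.prod_univ_succ, MeasurableEquiv.piFinSuccAbove_symm_apply, Fin.insertNthEquiv,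
      Fin.insertNth_zero', Equiv.coe_fn_mk, Fin.cons_zero, Fin.cons_succ, Fin.zero_succAbove]
    have hm : Measurable fun x : Fin n → α => ∏ i : Fin n, f i.succ (x i) :=
      Finset.measurable_prod _ fun i _ => (hf i.succ).comp (measurable_pi_apply i)
    rw [← ih (fun i => μ i.succ) fun i => hf i.succ]
    exact lintegral_prod_mul (hf 0).aemeasurable hm.aemeasurable

theorem pi_withDensity {n : ℕ} (μ : Fin n → Measure α) [∀ i, SigmaFinite (μ i)]
    {f : Fin n → α → ℝ≥0∞} (hf : ∀ i, Measurable (f i))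
    [∀ i, SigmaFinite ((μ i).withDensity (f i))] :
    Measure.pi (fun i => (μ i).withDensity (f i)) =
      (Measure.pi μ).withDensity fun x => ∏ i, f i (x i) := by
  refine Measure.pi_eq fun s hs => ?_
  rw [withDensity_apply _ (.univ_pi hs), ← lintegral_indicator (.univ_pi hs)]
  have h : ∀ x, (Set.univ.pi s).indicator (fun x => ∏ i, f i (x i)) x =
      ∏ i, (s i).indicator (f i) (x i) := by
    intro x
    by_cases hx : x ∈ Set.univ.pi s
    · rw [Set.indicator_of_mem hx]
      exact Finset.prod_congr rfl fun i _ => (Set.indicator_of_mem (hx i trivial) _).symm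
    · rw [Set.indicator_of_notMem hx]
      simp only [Set.mem_pi, Set.mem_univ, true_implies, not_forall] at hx
      obtain ⟨i, hi⟩ := hx
      exact (Finset.prod_eq_zero (Finset.mem_univ i) (Set.indicator_of_notMem hi _)).symm
  simp_rw [h]
  rw [lintegral_pi_prod _ fun i => (hf i).indicator (hs i)]
  exact Finset.prod_congr rfl fun i _ => by
    rw [lintegral_indicator (hs i), withDensity_apply _ (hs i)]

end PiDensity

/-! ### Density, characteristic function and second moments of `CN(0, 1)`. -/

section StdComplexGaussian

open Complex (I)

instance : IsProbabilityMeasure stdComplexGaussian := by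
  unfold stdComplexGaussian
  exact Measure.isProbabilityMeasure_map
    (Complex.measurableEquivRealProd.symm.measurable.aemeasurable)

theorem map_measurableEquivRealProd_symm_eq :
    stdComplexGaussian = ((gaussianReal 0 2⁻¹).prod (gaussianReal 0 2⁻¹)).map
      Complex.measurableEquivRealProd.symm := rfl

theorem stdComplexGaussian_eq_withDensity : stdComplexGaussian =
    volume.withDensity fun w : ℂ => ENNReal.ofReal (Real.pi⁻¹ * Real.exp (-‖w‖ ^ 2)) := by
  have hv : (2⁻¹ : NNReal) ≠ 0 := by simp
  refine Measure.ext_of_lintegral _ fun f hf => ?_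
  rw [map_measurableEquivRealProd_symm_eq, lintegral_map hf (by fun_prop),
    gaussianReal_of_var_ne_zero _ hv,
    prod_withDensity (measurable_gaussianPDF _ _) (measurable_gaussianPDF _ _),
    lintegral_withDensity_eq_lintegral_mul _ (by fun_prop) (by fun_prop),
    lintegral_withDensity_eq_lintegral_mul _ (by fun_prop) hf, ← Measure.volume_eq_prod,
    (Complex.volume_preserving_equiv_real_prod.symm).lintegral_map_equiv]
  refine lintegral_congr fun p => ?_
  simp only [Pi.mul_apply, gaussianPDF, gaussianPDFReal_def]
  congr 1
  rw [← ENNReal.ofReal_mul (by positivity)]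
  congr 1
  have h1 : ‖Complex.measurableEquivRealProd.symm p‖ ^ 2 = p.1 ^ 2 + p.2 ^ 2 := by
    rw [← Complex.normSq_eq_norm_sq, Complex.normSq_apply]
    simp [Complex.measurableEquivRealProd_symm_apply]; ring
  -- Variance `1/2` turns the normalisation `2πv` into `π`.
  have h2 : √(2 * Real.pi * ((2⁻¹ : NNReal) : ℝ)) = √Real.pi := by
    congr 1; push_cast; ring
  have h3 : (√Real.pi)⁻¹ * (√Real.pi)⁻¹ = Real.pi⁻¹ := by
    rw [← mul_inv, Real.mul_self_sqrt Real.pi_pos.le]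
  rw [h1, h2, mul_mul_mul_comm, h3, ← Real.exp_add]
  congr 2
  push_cast
  ring

/-- Real and imaginary parts of variance `1/2` each contribute `exp(-t²/4)`, which explains the
factor `4` here and below. -/
theorem charFunDual_stdComplexGaussian (L : StrongDual ℝ ℂ) :
    charFunDual stdComplexGaussian L = Complex.exp (-((L 1 ^ 2 + L I ^ 2 : ℝ) / 4 : ℂ)) := by
  have hL : ∀ p : ℝ × ℝ, L (Complex.measurableEquivRealProd.symm p) = L 1 * p.1 + L I * p.2 := by
    intro p
    have : Complex.measurableEquivRealProd.symm p = p.1 • (1 : ℂ) + p.2 • I := by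
      rw [Complex.measurableEquivRealProd_symm_apply]
      apply Complex.ext <;> simp
    rw [this, map_add, map_smul, map_smul, smul_eq_mul, smul_eq_mul]
    ring
  rw [charFunDual_apply, map_measurableEquivRealProd_symm_eq, integral_map_equiv]
  simp_rw [hL]
  have h1 : ∀ p : ℝ × ℝ, Complex.exp (((L 1 * p.1 + L I * p.2 : ℝ) : ℂ) * I) =
      Complex.exp ((L 1 : ℝ) * p.1 * I) * Complex.exp ((L I : ℝ) * p.2 * I) := by
    intro p
    rw [← Complex.exp_add]
    congr 1
    push_cast
    ring
  simp_rw [h1]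
  rw [integral_prod_mul (fun x : ℝ => Complex.exp ((L 1 : ℝ) * x * I))
    (fun x : ℝ => Complex.exp ((L I : ℝ) * x * I)), ← charFun_apply_real, ← charFun_apply_real,
    charFun_gaussianReal, charFun_gaussianReal, ← Complex.exp_add]
  congr 1
  push_cast
  ring

theorem lintegral_enorm_add_sq_stdComplexGaussian (a b : ℂ) :
    ∫⁻ w, ‖a * w + b‖ₑ ^ 2 ∂stdComplexGaussian = ‖a‖ₑ ^ 2 + ‖b‖ₑ ^ 2 := by
  have hs : ∀ z : ℂ, ‖z‖ₑ ^ 2 = ENNReal.ofReal (‖z‖ ^ 2) := by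
    intro z
    rw [ENNReal.ofReal_pow (norm_nonneg _), ofReal_norm]
  set g := gaussianReal 0 2⁻¹ with hg
  have i2 : Integrable (fun x : ℝ => x ^ 2) g := (memLp_id_gaussianReal 2).integrable_sq
  have i1 : Integrable (fun x : ℝ => x) g := (memLp_id_gaussianReal 1).integrable (by simp)
  have e1 : ∫ x, x ∂g = 0 := integral_id_gaussianReal
  have e2 : ∫ x, x ^ 2 ∂g = 2⁻¹ := by
    have h := variance_id_gaussianReal (μ := 0) (v := 2⁻¹)
    rw [variance_of_integral_eq_zero (by fun_prop) (by simp)] at h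
    simpa using h
  set c := a * (starRingEnd ℂ) b
  -- The cross term is linear in the two centred real coordinates and integrates to zero; the
  -- squares contribute `1/2 + 1/2`.
  have hx : ∀ p : ℝ × ℝ, ‖a * Complex.measurableEquivRealProd.symm p + b‖ ^ 2 =
      ‖a‖ ^ 2 * p.1 ^ 2 + ‖a‖ ^ 2 * p.2 ^ 2 + (2 * c.re * p.1 + -2 * c.im * p.2) + ‖b‖ ^ 2 := by
    intro p
    simp only [Complex.sq_norm, Complex.normSq_apply, Complex.measurableEquivRealProd_symm_apply, c]
    simp
    ring
  have j1 : Integrable (fun p : ℝ × ℝ => ‖a‖ ^ 2 * p.1 ^ 2) (g.prod g) := (i2.comp_fst g).const_mul _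
  have j2 : Integrable (fun p : ℝ × ℝ => ‖a‖ ^ 2 * p.2 ^ 2) (g.prod g) := (i2.comp_snd g).const_mul _
  have j3 : Integrable (fun p : ℝ × ℝ => 2 * c.re * p.1) (g.prod g) := (i1.comp_fst g).const_mul _
  have j4 : Integrable (fun p : ℝ × ℝ => -2 * c.im * p.2) (g.prod g) := (i1.comp_snd g).const_mul _
  rw [map_measurableEquivRealProd_symm_eq, lintegral_map_equiv]
  simp_rw [hs, hx]
  have j12 : Integrable (fun p : ℝ × ℝ => ‖a‖ ^ 2 * p.1 ^ 2 + ‖a‖ ^ 2 * p.2 ^ 2) (g.prod g) :=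
    j1.add j2
  have j34 : Integrable (fun p : ℝ × ℝ => 2 * c.re * p.1 + -2 * c.im * p.2) (g.prod g) := j3.add j4
  have j1234 : Integrable (fun p : ℝ × ℝ => ‖a‖ ^ 2 * p.1 ^ 2 + ‖a‖ ^ 2 * p.2 ^ 2 +
      (2 * c.re * p.1 + -2 * c.im * p.2)) (g.prod g) := j12.add j34
  have j5 : Integrable (fun p : ℝ × ℝ => ‖a‖ ^ 2 * p.1 ^ 2 + ‖a‖ ^ 2 * p.2 ^ 2 +
      (2 * c.re * p.1 + -2 * c.im * p.2) + ‖b‖ ^ 2) (g.prod g) :=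
    j1234.add (integrable_const _)
  rw [← ofReal_integral_eq_lintegral_ofReal j5
    (Filter.Eventually.of_forall fun p => by simp only [← hx]; positivity)]
  rw [← ENNReal.ofReal_add (by positivity) (by positivity)]
  congr 1
  rw [integral_add j1234 (integrable_const _), integral_add j12 j34,
    integral_add j1 j2, integral_add j3 j4]
  simp only [integral_const_mul]
  rw [integral_fun_fst (fun x : ℝ => x ^ 2), integral_fun_snd (fun x : ℝ => x ^ 2),
    integral_fun_fst (fun x : ℝ => x), integral_fun_snd (fun x : ℝ => x), e1, e2]
  simp
  ring

/-- Coordinate `0` is integrated first, with the remaining sum playing the role of the shift; hence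
the induction over all `b`. -/
theorem lintegral_enorm_dotProduct_add_sq {N : ℕ} (a : Fin N → ℂ) (b : ℂ) :
    ∫⁻ w, ‖a ⬝ᵥ w + b‖ₑ ^ 2 ∂(Measure.pi fun _ : Fin N => stdComplexGaussian) =
      ∑ i, ‖a i‖ₑ ^ 2 + ‖b‖ₑ ^ 2 := by
  induction N generalizing b with
  | zero => rw [Measure.pi_of_empty]; simp
  | succ n ih =>
    rw [((measurePreserving_piFinSuccAbove
      (fun _ : Fin (n + 1) => stdComplexGaussian) 0).symm).lintegral_map_equiv,
      lintegral_prod_symm _ (by unfold dotProduct; fun_prop)]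
    simp only [dotProduct, Fin.sum_univ_succ, MeasurableEquiv.piFinSuccAbove_symm_apply,
      Fin.insertNthEquiv,
      Fin.insertNth_zero', Equiv.coe_fn_mk, Fin.cons_zero, Fin.cons_succ, Fin.zero_succAbove,
      add_assoc, lintegral_enorm_add_sq_stdComplexGaussian]
    rw [lintegral_add_left (by fun_prop)]
    have := ih (fun i => a i.succ) b
    simp only [dotProduct] at this
    rw [this]
    simp

end StdComplexGaussian

/-! ### Square roots of covariances and inverse quadratic forms. -/

section MatrixLemmas

variable {m n : Type*} [Fintype m] [Fintype n]

theorem sum_norm_sq_mulVec (F : Matrix m n ℂ) (u : n → ℂ) :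
    ∑ k, ‖(F *ᵥ u) k‖ ^ 2 = (star u ⬝ᵥ (Fᴴ * F) *ᵥ u).re := by
  rw [← Matrix.mulVec_mulVec, Matrix.dotProduct_mulVec, Matrix.vecMul_conjTranspose, star_star]
  simp only [dotProduct, Complex.re_sum, Pi.star_apply, RCLike.star_def,
    ← Complex.normSq_eq_conj_mul_self,
    Complex.ofReal_re, Complex.normSq_eq_norm_sq]

theorem trace_mul_conjTranspose_re (F : Matrix m n ℂ) :
    (F * Fᴴ).trace.re = ∑ i, ∑ j, ‖F i j‖ ^ 2 := by
  simp only [Matrix.trace, Matrix.diag_apply, Matrix.mul_apply, Matrix.conjTranspose_apply,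
    Complex.re_sum, RCLike.star_def, Complex.mul_conj, Complex.ofReal_re, Complex.normSq_eq_norm_sq]

variable {N : ℕ} {S : Matrix (Fin N) (Fin N) ℂ}

theorem conjTranspose_sqrt (S : Matrix (Fin N) (Fin N) ℂ) : (CFC.sqrt S)ᴴ = CFC.sqrt S :=
  (CFC.sqrt_nonneg S).isSelfAdjoint

theorem sqrt_mul_sqrt (hS : S.PosSemidef) : CFC.sqrt S * CFC.sqrt S = S :=
  CFC.sqrt_mul_sqrt_self _ hS.nonneg

theorem isUnit_det_sqrt (hS : S.PosDef) : IsUnit (CFC.sqrt S).det := by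
  have h : (CFC.sqrt S).det * (CFC.sqrt S).det = S.det := by
    rw [← Matrix.det_mul, sqrt_mul_sqrt hS.posSemidef]
  refine isUnit_iff_ne_zero.mpr fun h0 => hS.det_pos.ne' ?_
  rw [← h, h0, zero_mul]

theorem conjTranspose_inv_sqrt_mul_inv_sqrt (hS : S.PosSemidef) :
    ((CFC.sqrt S)⁻¹)ᴴ * (CFC.sqrt S)⁻¹ = S⁻¹ := by
  rw [Matrix.conjTranspose_nonsing_inv, conjTranspose_sqrt, ← Matrix.mul_inv_rev,
    sqrt_mul_sqrt hS]

theorem det_re_pos (hS : S.PosDef) : 0 < S.det.re := (Complex.lt_def.mp hS.det_pos).1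

theorem det_im_eq_zero (hS : S.PosDef) : S.det.im = 0 := (Complex.lt_def.mp hS.det_pos).2.symm

theorem norm_det_sqrt_sq (hS : S.PosDef) : ‖(CFC.sqrt S).det‖ ^ 2 = S.det.re := by
  have h : (CFC.sqrt S).det * star (CFC.sqrt S).det = S.det := by
    rw [← Matrix.det_conjTranspose, conjTranspose_sqrt, ← Matrix.det_mul,
      sqrt_mul_sqrt hS.posSemidef]
  rw [← h, RCLike.star_def, Complex.mul_conj, Complex.ofReal_re, Complex.normSq_eq_norm_sq]

/-- The quadratic form `uᴴ S⁻¹ u`. -/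
noncomputable def invQuadForm (S : Matrix (Fin N) (Fin N) ℂ) (u : Fin N → ℂ) : ℝ :=
  (star u ⬝ᵥ S⁻¹ *ᵥ u).re

theorem invQuadForm_eq_sum (hS : S.PosSemidef) (u : Fin N → ℂ) :
    invQuadForm S u = ∑ k, ‖((CFC.sqrt S)⁻¹ *ᵥ u) k‖ ^ 2 := by
  rw [sum_norm_sq_mulVec, conjTranspose_inv_sqrt_mul_inv_sqrt hS, invQuadForm]

theorem invQuadForm_nonneg (hS : S.PosSemidef) (u : Fin N → ℂ) : 0 ≤ invQuadForm S u := by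
  rw [invQuadForm_eq_sum hS]; positivity

theorem ofReal_sum_norm_sq {ι : Type*} [Fintype ι] (u : ι → ℂ) :
    ENNReal.ofReal (∑ k, ‖u k‖ ^ 2) = ∑ k, ‖u k‖ₑ ^ 2 := by
  rw [ENNReal.ofReal_sum_of_nonneg fun _ _ => by positivity]
  exact Finset.sum_congr rfl fun k _ => by
    rw [ENNReal.ofReal_pow (norm_nonneg _), ofReal_norm]

theorem ofReal_invQuadForm (hS : S.PosSemidef) (u : Fin N → ℂ) :
    ENNReal.ofReal (invQuadForm S u) = ∑ k, ‖((CFC.sqrt S)⁻¹ *ᵥ u) k‖ₑ ^ 2 := by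
  rw [invQuadForm_eq_sum hS, ofReal_sum_norm_sq]

@[fun_prop]
theorem continuous_invQuadForm (S : Matrix (Fin N) (Fin N) ℂ) : Continuous (invQuadForm S) := by
  unfold invQuadForm; fun_prop

end MatrixLemmas

/-! ### Moments and density of complex Gaussian vectors. -/

section ComplexGaussian

open Complex (I)

variable {N K : ℕ} {S C : Matrix (Fin N) (Fin N) ℂ}

theorem measurable_mulVec_const {m n : Type*} [Fintype n] (F : Matrix m n ℂ) :
    Measurable fun w : n → ℂ => F *ᵥ w :=
  measurable_pi_lambda _ fun i => by unfold Matrix.mulVec dotProduct; fun_prop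

instance (S : Matrix (Fin N) (Fin N) ℂ) : IsProbabilityMeasure (complexGaussian S) :=
  Measure.isProbabilityMeasure_map (measurable_mulVec_const _).aemeasurable

theorem lintegral_complexGaussian (S : Matrix (Fin N) (Fin N) ℂ) {f : (Fin N → ℂ) → ℝ≥0∞}
    (hf : Measurable f) : ∫⁻ z, f z ∂(complexGaussian S) =
      ∫⁻ w, f (CFC.sqrt S *ᵥ w) ∂(Measure.pi fun _ : Fin N => stdComplexGaussian) :=
  lintegral_map hf (measurable_mulVec_const _)

theorem lintegral_sum_enorm_mulVec_add_sq (hS : S.PosSemidef) (F : Matrix (Fin K) (Fin N) ℂ)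
    (d : Fin K → ℂ) :
    ∫⁻ z, ∑ k, ‖(F *ᵥ z + d) k‖ₑ ^ 2 ∂(complexGaussian S) =
      ENNReal.ofReal (F * S * Fᴴ).trace.re + ∑ k, ‖d k‖ₑ ^ 2 := by
  have hF := measurable_mulVec_const F
  have hm : ∀ k, Measurable fun z : Fin N → ℂ => (F *ᵥ z + d) k := fun k =>
    ((measurable_pi_apply k).comp hF).add_const _
  rw [lintegral_complexGaussian _ (Finset.measurable_sum _ fun k _ => (hm k).enorm.pow_const 2)]
  have hR : ∀ w, F *ᵥ (CFC.sqrt S *ᵥ w) = (F * CFC.sqrt S) *ᵥ w := fun w => by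
    rw [Matrix.mulVec_mulVec]
  simp_rw [hR]
  have hm' : ∀ k, Measurable fun z : Fin N → ℂ => ((F * CFC.sqrt S) *ᵥ z + d) k := fun k =>
    ((measurable_pi_apply k).comp (measurable_mulVec_const _)).add_const _
  rw [lintegral_finsetSum _ fun k _ => (hm' k).enorm.pow_const 2]
  have h1 : ∀ k, ∫⁻ w, ‖((F * CFC.sqrt S) *ᵥ w + d) k‖ₑ ^ 2
      ∂(Measure.pi fun _ : Fin N => stdComplexGaussian) =
      ∑ i, ‖(F * CFC.sqrt S) k i‖ₑ ^ 2 + ‖d k‖ₑ ^ 2 := fun k =>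
    lintegral_enorm_dotProduct_add_sq _ _
  simp_rw [h1]
  rw [Finset.sum_add_distrib]
  congr 1
  have h2 : F * S * Fᴴ = (F * CFC.sqrt S) * (F * CFC.sqrt S)ᴴ := by
    rw [Matrix.conjTranspose_mul, conjTranspose_sqrt]
    conv_lhs => rw [← sqrt_mul_sqrt hS]
    simp only [Matrix.mul_assoc]
  rw [h2, trace_mul_conjTranspose_re, ENNReal.ofReal_sum_of_nonneg fun _ _ => by positivity]
  exact Finset.sum_congr rfl fun k _ => (ofReal_sum_norm_sq _).symm

/-- By cyclicity this is the trace of the positive semidefinite matrix `S^{1/2} C⁻¹ S^{1/2}`. -/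
theorem re_trace_mul_inv_nonneg (hC : C.PosSemidef) (hS : S.PosSemidef) :
    0 ≤ (C⁻¹ * S).trace.re := by
  have h : (C⁻¹ * S).trace = (CFC.sqrt S * C⁻¹ * (CFC.sqrt S)ᴴ).trace := by
    rw [conjTranspose_sqrt]
    conv_lhs => rw [← sqrt_mul_sqrt hS]
    rw [← Matrix.mul_assoc, Matrix.trace_mul_comm, Matrix.mul_assoc]
  rw [h]
  exact (Complex.le_def.mp (hC.inv.mul_mul_conjTranspose_same _).trace_nonneg).1

/-- The form is the squared norm of `C^{-1/2}(F z + d)`, so the second-moment formula applies; the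
trace is then rearranged cyclically. -/
theorem lintegral_invQuadForm_mulVec_add (hC : C.PosSemidef) {T : Matrix (Fin K) (Fin K) ℂ}
    (hT : T.PosSemidef) (F : Matrix (Fin N) (Fin K) ℂ) (d : Fin N → ℂ) :
    ∫⁻ z, ENNReal.ofReal (invQuadForm C (F *ᵥ z + d)) ∂(complexGaussian T) =
      ENNReal.ofReal (C⁻¹ * (F * T * Fᴴ)).trace.re + ENNReal.ofReal (invQuadForm C d) := by
  simp_rw [ofReal_invQuadForm hC, Matrix.mulVec_add, Matrix.mulVec_mulVec]
  rw [lintegral_sum_enorm_mulVec_add_sq hT]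
  congr 3
  rw [Matrix.conjTranspose_mul, ← conjTranspose_inv_sqrt_mul_inv_sqrt hC,
    Matrix.mul_assoc _ _ (F * T * Fᴴ)]
  conv_rhs => rw [Matrix.trace_mul_comm]
  simp only [Matrix.mul_assoc]

/-- The density of the complex Gaussian law of mean `m` and covariance `S`. -/
noncomputable def complexGaussianDensity (S : Matrix (Fin N) (Fin N) ℂ) (m y : Fin N → ℂ) : ℝ :=
  (Real.pi ^ N * S.det.re)⁻¹ * Real.exp (-invQuadForm S (y - m))

theorem complexGaussianDensity_pos (hS : S.PosDef) (m y : Fin N → ℂ) :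
    0 < complexGaussianDensity S m y := by
  have := det_re_pos hS
  unfold complexGaussianDensity
  positivity

@[fun_prop]
theorem measurable_complexGaussianDensity (S : Matrix (Fin N) (Fin N) ℂ) (m : Fin N → ℂ) :
    Measurable (complexGaussianDensity S m) := by
  unfold complexGaussianDensity
  exact Continuous.measurable (by fun_prop)

theorem pi_stdComplexGaussian_eq_withDensity :
    Measure.pi (fun _ : Fin N => stdComplexGaussian) =
      volume.withDensity fun w : Fin N → ℂ =>
        ENNReal.ofReal ((Real.pi ^ N)⁻¹ * Real.exp (-∑ k, ‖w k‖ ^ 2)) := by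
  have : IsProbabilityMeasure (volume.withDensity fun w : ℂ =>
      ENNReal.ofReal (Real.pi⁻¹ * Real.exp (-‖w‖ ^ 2))) := by
    rw [← stdComplexGaussian_eq_withDensity]; infer_instance
  rw [stdComplexGaussian_eq_withDensity, pi_withDensity _ fun _ => by fun_prop, volume_pi]
  congr 1
  ext w
  rw [← ENNReal.ofReal_prod_of_nonneg fun _ _ => by positivity, Finset.prod_mul_distrib,
    ← Real.exp_sum, Finset.sum_neg_distrib]
  simp

/-- The real determinant of a complex-linear map is the squared modulus of its complex determinant.
-/
theorem map_mulVec_volume {R : Matrix (Fin N) (Fin N) ℂ} (hR : IsUnit R.det) :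
    (volume : Measure (Fin N → ℂ)).map (fun w => R *ᵥ w) =
      ENNReal.ofReal (‖R.det‖ ^ 2)⁻¹ • volume := by
  have hdet : LinearMap.det ((Matrix.toLin' R).restrictScalars ℝ) = ‖R.det‖ ^ 2 := by
    rw [LinearMap.det_restrictScalars, Algebra.norm_complex_eq, LinearMap.det_toLin',
      ← Complex.normSq_eq_norm_sq]
    rfl
  have h0 : LinearMap.det ((Matrix.toLin' R).restrictScalars ℝ) ≠ 0 := by
    rw [hdet]
    exact pow_ne_zero _ (norm_ne_zero_iff.mpr hR.ne_zero)
  have h := Measure.map_linearMap_addHaar_eq_smul_addHaar (volume : Measure (Fin N → ℂ)) h0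
  rw [hdet, abs_of_nonneg (by positivity)] at h
  exact h

/-- The complex Gaussian law of mean `m` and covariance `S`. -/
noncomputable def shiftedGaussian (S : Matrix (Fin N) (Fin N) ℂ) (m : Fin N → ℂ) :
    Measure (Fin N → ℂ) :=
  (complexGaussian S).map fun z => m + z

instance (S : Matrix (Fin N) (Fin N) ℂ) (m : Fin N → ℂ) :
    IsProbabilityMeasure (shiftedGaussian S m) :=
  Measure.isProbabilityMeasure_map (by fun_prop)

/-- The substitution `y = m + S^{1/2} w` has real Jacobian `|det S^{1/2}|² = det S`. -/
theorem shiftedGaussian_eq_withDensity (hS : S.PosDef) (m : Fin N → ℂ) :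
    shiftedGaussian S m =
      volume.withDensity fun y => ENNReal.ofReal (complexGaussianDensity S m y) := by
  have hdm : Measurable fun y => ENNReal.ofReal (complexGaussianDensity S m y) := by
    fun_prop
  have hdet := det_re_pos hS
  refine Measure.ext_of_lintegral _ fun f hf => ?_
  have hR := isUnit_det_sqrt hS
  have hRm := measurable_mulVec_const (CFC.sqrt S)
  rw [shiftedGaussian, lintegral_map hf (by fun_prop), lintegral_complexGaussian _ (by fun_prop),
    pi_stdComplexGaussian_eq_withDensity,
    lintegral_withDensity_eq_lintegral_mul _ (by fun_prop) (by fun_prop),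
    lintegral_withDensity_eq_lintegral_mul _ hdm hf]
  have h1 : ∀ w : Fin N → ℂ, ENNReal.ofReal ((Real.pi ^ N)⁻¹ * Real.exp (-∑ k, ‖w k‖ ^ 2)) =
      ENNReal.ofReal S.det.re *
        ENNReal.ofReal (complexGaussianDensity S m (m + CFC.sqrt S *ᵥ w)) := by
    intro w
    rw [← ENNReal.ofReal_mul hdet.le, complexGaussianDensity, add_sub_cancel_left,
      invQuadForm_eq_sum hS.posSemidef, Matrix.mulVec_mulVec, Matrix.nonsing_inv_mul _ hR,
      Matrix.one_mulVec]
    congr 1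
    field_simp
  simp only [Pi.mul_apply, h1, mul_assoc]
  rw [lintegral_const_mul _ (by fun_prop),
    ← lintegral_map (f := fun z => ENNReal.ofReal (complexGaussianDensity S m (m + z)) * f (m + z))
      (by fun_prop) hRm, map_mulVec_volume hR, lintegral_smul_measure, norm_det_sqrt_sq hS,
    lintegral_add_left_eq_self (fun z => ENNReal.ofReal (complexGaussianDensity S m z) * f z) m,
    smul_eq_mul, ← mul_assoc, ← ENNReal.ofReal_mul hdet.le, mul_inv_cancel₀ hdet.ne',
    ENNReal.ofReal_one, one_mul]

end ComplexGaussian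

/-! ### Divergence between two complex Gaussian laws. -/

section GaussianDivergence

open InformationTheory

variable {N : ℕ} {S C : Matrix (Fin N) (Fin N) ℂ}

/-- The divergence of `CN(m, S)` from `CN(m, C)` in nats. -/
noncomputable def gaussianDivergence (S C : Matrix (Fin N) (Fin N) ℂ) : ℝ :=
  Real.log C.det.re - Real.log S.det.re - N + (C⁻¹ * S).trace.re

theorem lintegral_invQuadForm_shiftedGaussian (hS : S.PosSemidef) (hC : C.PosSemidef)
    (a b : Fin N → ℂ) :
    ∫⁻ y, ENNReal.ofReal (invQuadForm C (y - b)) ∂(shiftedGaussian S a) =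
      ENNReal.ofReal ((C⁻¹ * S).trace.re + invQuadForm C (a - b)) := by
  have hsub : ∀ z : Fin N → ℂ, a + z - b = (1 : Matrix (Fin N) (Fin N) ℂ) *ᵥ z + (a - b) := by
    intro z; rw [Matrix.one_mulVec]; abel
  rw [shiftedGaussian, lintegral_map (by fun_prop) (by fun_prop)]
  simp_rw [hsub]
  rw [lintegral_invQuadForm_mulVec_add hC hS, Matrix.conjTranspose_one, Matrix.mul_one,
    Matrix.one_mul, ENNReal.ofReal_add (re_trace_mul_inv_nonneg hC hS) (invQuadForm_nonneg hC _)]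

theorem integrable_invQuadForm_shiftedGaussian (hS : S.PosSemidef) (hC : C.PosSemidef)
    (a b : Fin N → ℂ) :
    Integrable (fun y => invQuadForm C (y - b)) (shiftedGaussian S a) := by
  refine (lintegral_ofReal_ne_top_iff_integrable (Continuous.aestronglyMeasurable
    (by fun_prop)) (Filter.Eventually.of_forall fun y => invQuadForm_nonneg hC _)).mp ?_
  rw [lintegral_invQuadForm_shiftedGaussian hS hC]
  exact ENNReal.ofReal_ne_top

theorem integral_invQuadForm_shiftedGaussian (hS : S.PosSemidef) (hC : C.PosSemidef)
    (a b : Fin N → ℂ) :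
    ∫ y, invQuadForm C (y - b) ∂(shiftedGaussian S a) =
      (C⁻¹ * S).trace.re + invQuadForm C (a - b) := by
  rw [integral_eq_lintegral_of_nonneg_ae
    (Filter.Eventually.of_forall fun y => invQuadForm_nonneg hC _)
    (Continuous.aestronglyMeasurable (by fun_prop)),
    lintegral_invQuadForm_shiftedGaussian hS hC, ENNReal.toReal_ofReal
    (add_nonneg (re_trace_mul_inv_nonneg hC hS) (invQuadForm_nonneg hC _))]

theorem shiftedGaussian_eq_withDensity_shiftedGaussian (hS : S.PosDef) (hC : C.PosDef)
    (a b : Fin N → ℂ) :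
    shiftedGaussian S a = (shiftedGaussian C b).withDensity fun y =>
      ENNReal.ofReal (complexGaussianDensity S a y / complexGaussianDensity C b y) := by
  rw [shiftedGaussian_eq_withDensity hS, shiftedGaussian_eq_withDensity hC,
    ← withDensity_mul _ (by fun_prop) (by fun_prop)]
  congr 1
  ext y
  rw [Pi.mul_apply, ← ENNReal.ofReal_mul (complexGaussianDensity_pos hC b y).le,
    mul_div_cancel₀ _ (complexGaussianDensity_pos hC b y).ne']

theorem shiftedGaussian_absolutelyContinuous (hS : S.PosDef) (hC : C.PosDef) (a b : Fin N → ℂ) :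
    shiftedGaussian S a ≪ shiftedGaussian C b := by
  rw [shiftedGaussian_eq_withDensity_shiftedGaussian hS hC a b]
  exact withDensity_absolutelyContinuous _ _

theorem log_complexGaussianDensity_div (hS : S.PosDef) (hC : C.PosDef) (a b y : Fin N → ℂ) :
    Real.log (complexGaussianDensity S a y / complexGaussianDensity C b y) =
      Real.log C.det.re - Real.log S.det.re - invQuadForm S (y - a) + invQuadForm C (y - b) := by
  have h1 := det_re_pos hS
  have h2 := det_re_pos hC
  have hpi : (0 : ℝ) < Real.pi ^ N := by positivity
  rw [Real.log_div (complexGaussianDensity_pos hS a y).ne' (complexGaussianDensity_pos hC b y).ne',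
    complexGaussianDensity, complexGaussianDensity,
    Real.log_mul (inv_ne_zero (by positivity)) (Real.exp_ne_zero _), Real.log_mul
    (inv_ne_zero (by positivity)) (Real.exp_ne_zero _), Real.log_exp, Real.log_exp, Real.log_inv,
    Real.log_inv, Real.log_mul hpi.ne' h1.ne', Real.log_mul hpi.ne' h2.ne']
  ring

theorem llr_shiftedGaussian (hS : S.PosDef) (hC : C.PosDef) (a b : Fin N → ℂ) :
    llr (shiftedGaussian S a) (shiftedGaussian C b) =ᵐ[shiftedGaussian S a] fun y =>
      Real.log C.det.re - Real.log S.det.re - invQuadForm S (y - a) + invQuadForm C (y - b) := by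
  refine (shiftedGaussian_absolutelyContinuous hS hC a b).ae_le ?_
  have h : (shiftedGaussian S a).rnDeriv (shiftedGaussian C b) =ᵐ[shiftedGaussian C b] fun y =>
      ENNReal.ofReal (complexGaussianDensity S a y / complexGaussianDensity C b y) := by
    rw [shiftedGaussian_eq_withDensity_shiftedGaussian hS hC a b]
    exact Measure.rnDeriv_withDensity _ (by fun_prop)
  filter_upwards [h] with y hy
  rw [llr_def]
  simp only
  rw [hy, ENNReal.toReal_ofReal (div_nonneg (complexGaussianDensity_pos hS a y).le
    (complexGaussianDensity_pos hC b y).le), log_complexGaussianDensity_div hS hC]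

theorem integrable_llr_shiftedGaussian (hS : S.PosDef) (hC : C.PosDef) (a b : Fin N → ℂ) :
    Integrable (llr (shiftedGaussian S a) (shiftedGaussian C b)) (shiftedGaussian S a) :=
  (integrable_congr (llr_shiftedGaussian hS hC a b)).mpr
    (((integrable_const _).sub
      (integrable_invQuadForm_shiftedGaussian hS.posSemidef hS.posSemidef a a)).add
      (integrable_invQuadForm_shiftedGaussian hS.posSemidef hC.posSemidef a b))

theorem trace_inv_mul_self (hS : S.PosDef) : (S⁻¹ * S).trace.re = N := by
  rw [Matrix.nonsing_inv_mul _ (isUnit_iff_ne_zero.mpr hS.det_pos.ne')]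
  simp

theorem invQuadForm_zero (S : Matrix (Fin N) (Fin N) ℂ) : invQuadForm S 0 = 0 := by
  simp [invQuadForm]

theorem integral_llr_shiftedGaussian (hS : S.PosDef) (hC : C.PosDef) (a b : Fin N → ℂ) :
    ∫ y, llr (shiftedGaussian S a) (shiftedGaussian C b) y ∂(shiftedGaussian S a) =
      gaussianDivergence S C + invQuadForm C (a - b) := by
  have i1 := integrable_invQuadForm_shiftedGaussian hS.posSemidef hS.posSemidef a a
  have i2 := integrable_invQuadForm_shiftedGaussian hS.posSemidef hC.posSemidef a b
  have i3 : Integrable (fun y => Real.log C.det.re - Real.log S.det.re - invQuadForm S (y - a))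
      (shiftedGaussian S a) := (integrable_const _).sub i1
  rw [integral_congr_ae (llr_shiftedGaussian hS hC a b),
    integral_add i3 i2, integral_sub (integrable_const _) i1,
    integral_invQuadForm_shiftedGaussian hS.posSemidef hS.posSemidef,
    integral_invQuadForm_shiftedGaussian hS.posSemidef hC.posSemidef, trace_inv_mul_self hS,
    sub_self, invQuadForm_zero, gaussianDivergence]
  simp
  ring

/-- Nonnegativity of divergence at equal means. It is the source of all the log-determinant
inequalities below. -/
theorem gaussianDivergence_nonneg (hS : S.PosDef) (hC : C.PosDef) :
    0 ≤ gaussianDivergence S C := by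
  have h := integral_llr_add_sub_measure_univ_nonneg
    (shiftedGaussian_absolutelyContinuous hS hC 0 0) (integrable_llr_shiftedGaussian hS hC 0 0)
  rw [integral_llr_shiftedGaussian hS hC, sub_self, invQuadForm_zero] at h
  simpa using h

/-- The means enter only through a separate quadratic term, which is what makes the mean divergence
quadratic in the channel input. -/
theorem klDiv_shiftedGaussian (hS : S.PosDef) (hC : C.PosDef) (a b : Fin N → ℂ) :
    klDiv (shiftedGaussian S a) (shiftedGaussian C b) =
      ENNReal.ofReal (gaussianDivergence S C) + ENNReal.ofReal (invQuadForm C (a - b)) := by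
  rw [klDiv_of_ac_of_integrable (shiftedGaussian_absolutelyContinuous hS hC a b)
    (integrable_llr_shiftedGaussian hS hC a b), integral_llr_shiftedGaussian hS hC,
    ← ENNReal.ofReal_add (gaussianDivergence_nonneg hS hC) (invQuadForm_nonneg hC.posSemidef _)]
  simp

end GaussianDivergence

/-! ### Characteristic functions and the independence of observation and estimation error. -/

section CharFun

open Complex (I)

variable {K M N N₁ N₂ : ℕ}

/-- The real-linear functional `z ↦ Re (tᴴ z)`. -/
noncomputable def reDual (t : Fin N → ℂ) : StrongDual ℝ (Fin N → ℂ) where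
  toFun z := (star t ⬝ᵥ z).re
  map_add' x y := by rw [dotProduct_add, Complex.add_re]
  map_smul' c x := by rw [dotProduct_smul, Complex.real_smul, Complex.re_ofReal_mul]; rfl
  cont := by fun_prop

theorem reDual_apply (t z : Fin N → ℂ) : reDual t z = (star t ⬝ᵥ z).re := rfl

theorem reDual_add (s t z : Fin N → ℂ) : reDual (s + t) z = reDual s z + reDual t z := by
  simp [reDual_apply, add_dotProduct]

theorem reDual_sub (s t z : Fin N → ℂ) : reDual (s - t) z = reDual s z - reDual t z := by
  simp [reDual_apply, sub_dotProduct]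

theorem reDual_mulVec (t : Fin N → ℂ) (F : Matrix (Fin N) (Fin K) ℂ) (z : Fin K → ℂ) :
    reDual t (F *ᵥ z) = reDual (Fᴴ *ᵥ t) z := by
  rw [reDual_apply, reDual_apply, Matrix.star_mulVec, Matrix.conjTranspose_conjTranspose,
    Matrix.dotProduct_mulVec]

theorem reDual_single (t : Fin N → ℂ) (k : Fin N) (c : ℂ) :
    reDual t (Pi.single k c) = (star (t k) * c).re := by
  rw [reDual_apply, dotProduct_single]; rfl

theorem exists_eq_reDual (L : StrongDual ℝ (Fin N → ℂ)) : ∃ t, L = reDual t := by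
  -- The values on `e_k` and `i e_k` are the real and imaginary parts of `t k`, as `Re (conj (t k) *
  -- I) = Im (t k)`.
  refine ⟨fun k => ⟨L (Pi.single k 1), L (Pi.single k I)⟩, ?_⟩
  ext z
  have hz : z = ∑ k, ((z k).re • (Pi.single k 1 : Fin N → ℂ) +
        (z k).im • (Pi.single k I : Fin N → ℂ)) := by
    ext j
    rw [Finset.sum_apply, Finset.sum_eq_single j]
    · apply Complex.ext <;> simp
    · intro k _ hk; simp [Pi.single_eq_of_ne hk.symm]
    · simp
  conv_lhs => rw [hz]
  conv_rhs => rw [hz]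
  simp only [map_sum, map_add, map_smul, reDual_single]
  simp

theorem integral_exp_reDual_pi (t : Fin N → ℂ) :
    ∫ w, Complex.exp (reDual t w * I) ∂(Measure.pi fun _ : Fin N => stdComplexGaussian) =
      Complex.exp (-(star t ⬝ᵥ t) / 4) := by
  rw [← charFunDual_apply, charFunDual_pi]
  simp_rw [charFunDual_stdComplexGaussian]
  rw [← Complex.exp_sum]
  congr 1
  rw [Finset.sum_neg_distrib, neg_div, dotProduct, Finset.sum_div]
  congr 1
  refine Finset.sum_congr rfl fun k _ => ?_
  congr 1
  simp only [ContinuousLinearMap.comp_apply, ContinuousLinearMap.single_apply, reDual_single,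
    Pi.star_apply, RCLike.star_def]
  rw [← Complex.normSq_eq_conj_mul_self, Complex.normSq_apply]
  simp
  ring

theorem integral_exp_reDual_complexGaussian {S : Matrix (Fin N) (Fin N) ℂ} (hS : S.PosSemidef)
    (t : Fin N → ℂ) :
    ∫ z, Complex.exp (reDual t z * I) ∂(complexGaussian S) =
      Complex.exp (-(star t ⬝ᵥ S *ᵥ t) / 4) := by
  rw [complexGaussian, integral_map (measurable_mulVec_const _).aemeasurable
    (Continuous.aestronglyMeasurable (by fun_prop))]
  simp_rw [reDual_mulVec]
  rw [integral_exp_reDual_pi, conjTranspose_sqrt, Matrix.star_mulVec, conjTranspose_sqrt,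
    ← Matrix.dotProduct_mulVec, Matrix.mulVec_mulVec, sqrt_mul_sqrt hS]

theorem star_mulVec_dotProduct_mulVec {m n k : Type*} [Fintype m] [Fintype n] [Fintype k]
    (F : Matrix m n ℂ) (G : Matrix k n ℂ) (S : Matrix n n ℂ) (s : m → ℂ) (t : k → ℂ) :
    star (Fᴴ *ᵥ s) ⬝ᵥ S *ᵥ (Gᴴ *ᵥ t) = star s ⬝ᵥ (F * S * Gᴴ) *ᵥ t := by
  rw [Matrix.star_mulVec, Matrix.conjTranspose_conjTranspose, ← Matrix.dotProduct_mulVec,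
    Matrix.mulVec_mulVec, Matrix.mulVec_mulVec, Matrix.mul_assoc]

/-- The estimation error `A x + n₁ - T (B x + n₂)` of the linear minimum mean square error
estimator `T` is Gaussian and independent of the observation `B x + n₂`. -/
theorem map_observation_error_eq_prod {R : Matrix (Fin M) (Fin M) ℂ}
    {S₁ : Matrix (Fin N₁) (Fin N₁) ℂ} {S₂ : Matrix (Fin N₂) (Fin N₂) ℂ}
    (hR : R.PosSemidef) (hS₁ : S₁.PosSemidef) (hS₂ : S₂.PosSemidef)
    (A : Matrix (Fin N₁) (Fin M) ℂ) (B : Matrix (Fin N₂) (Fin M) ℂ)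
    (T : Matrix (Fin N₁) (Fin N₂) ℂ) (hT : (A - T * B) * R * Bᴴ = T * S₂) :
    ((complexGaussian R).prod ((complexGaussian S₁).prod (complexGaussian S₂))).map
        (fun p => (B *ᵥ p.1 + p.2.2, A *ᵥ p.1 + p.2.1 - T *ᵥ (B *ᵥ p.1 + p.2.2))) =
      (((complexGaussian R).prod (complexGaussian S₂)).map fun p => B *ᵥ p.1 + p.2).prod
        (complexGaussian (S₁ + T * S₂ * Tᴴ + (A - T * B) * R * (A - T * B)ᴴ)) := by
  have mB : Measurable fun p : (Fin M → ℂ) × (Fin N₂ → ℂ) => B *ᵥ p.1 + p.2 :=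
    ((measurable_mulVec_const B).comp measurable_fst).add measurable_snd
  have mBT : Measurable fun p : (Fin M → ℂ) × (Fin N₁ → ℂ) × (Fin N₂ → ℂ) =>
      (B *ᵥ p.1 + p.2.2, A *ᵥ p.1 + p.2.1 - T *ᵥ (B *ᵥ p.1 + p.2.2)) :=
    Continuous.measurable (by fun_prop)
  have := Measure.isProbabilityMeasure_map (μ := (complexGaussian R).prod (complexGaussian S₂))
    mB.aemeasurable
  have := Measure.isProbabilityMeasure_map
    (μ := (complexGaussian R).prod ((complexGaussian S₁).prod (complexGaussian S₂)))
    mBT.aemeasurable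
  set E := A - T * B with hE
  have hC : (S₁ + T * S₂ * Tᴴ + E * R * Eᴴ).PosSemidef :=
    (hS₁.add (hS₂.mul_mul_conjTranspose_same T)).add (hR.mul_mul_conjTranspose_same E)
  -- The adjoint of the orthogonality condition `hT`; it removes the other cross term.
  have hT' : B * R * Eᴴ = S₂ * Tᴴ := by
    have h := congrArg Matrix.conjTranspose hT
    simp only [Matrix.conjTranspose_mul, Matrix.conjTranspose_conjTranspose, hR.1.eq, hS₂.1.eq] at h
    rw [Matrix.mul_assoc, h]
  -- Joint normality is not invoked: it suffices that the joint characteristic function factors.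
  refine charFunDual_eq_prod_iff.mp fun L => ?_
  obtain ⟨s, hs⟩ := exists_eq_reDual (L.comp (.inl ℝ _ _))
  obtain ⟨t, ht⟩ := exists_eq_reDual (L.comp (.inr ℝ _ _))
  have hL : ∀ p, L p = reDual s p.1 + reDual t p.2 := by
    intro p
    rw [← hs, ← ht, L.comp_inl_add_comp_inr]
  rw [hs, ht, charFunDual_apply, charFunDual_apply, charFunDual_apply,
    integral_map mBT.aemeasurable (Continuous.aestronglyMeasurable (by fun_prop)),
    integral_map mB.aemeasurable (Continuous.aestronglyMeasurable (by fun_prop)),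
    integral_exp_reDual_complexGaussian hC]
  -- The exponent is regrouped by the independent sources `x`, `n₁`, `n₂`.
  have e1 : ∀ p : (Fin M → ℂ) × (Fin N₁ → ℂ) × (Fin N₂ → ℂ),
      Complex.exp (L (B *ᵥ p.1 + p.2.2, A *ᵥ p.1 + p.2.1 - T *ᵥ (B *ᵥ p.1 + p.2.2)) * I) =
      Complex.exp (reDual (Bᴴ *ᵥ s + Eᴴ *ᵥ t) p.1 * I) *
        (Complex.exp (reDual t p.2.1 * I) * Complex.exp (reDual (s - Tᴴ *ᵥ t) p.2.2 * I)) := by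
    intro p
    rw [← Complex.exp_add, ← Complex.exp_add]
    congr 1
    rw [hL, reDual_add, reDual_sub, ← reDual_mulVec, ← reDual_mulVec, ← reDual_mulVec, hE,
      Matrix.sub_mulVec, ← Matrix.mulVec_mulVec]
    simp only [map_add, map_sub, Matrix.mulVec_add]
    push_cast
    ring
  have e2 : ∀ p : (Fin M → ℂ) × (Fin N₂ → ℂ),
      Complex.exp (reDual s (B *ᵥ p.1 + p.2) * I) =
      Complex.exp (reDual (Bᴴ *ᵥ s) p.1 * I) * Complex.exp (reDual s p.2 * I) := by
    intro p
    rw [← Complex.exp_add, map_add, reDual_mulVec]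
    congr 1
    push_cast
    ring
  simp_rw [e1, e2]
  rw [integral_prod_mul (fun x => Complex.exp (reDual (Bᴴ *ᵥ s + Eᴴ *ᵥ t) x * I))
    (fun q : (Fin N₁ → ℂ) × (Fin N₂ → ℂ) =>
      Complex.exp (reDual t q.1 * I) * Complex.exp (reDual (s - Tᴴ *ᵥ t) q.2 * I)),
    integral_prod_mul (fun x => Complex.exp (reDual t x * I))
      (fun x => Complex.exp (reDual (s - Tᴴ *ᵥ t) x * I)),
    integral_prod_mul (fun x => Complex.exp (reDual (Bᴴ *ᵥ s) x * I))
      (fun x => Complex.exp (reDual s x * I)),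
    integral_exp_reDual_complexGaussian hR, integral_exp_reDual_complexGaussian hR,
    integral_exp_reDual_complexGaussian hS₁, integral_exp_reDual_complexGaussian hS₂,
    integral_exp_reDual_complexGaussian hS₂, ← Complex.exp_add, ← Complex.exp_add,
    ← Complex.exp_add, ← Complex.exp_add]
  congr 1
  -- The cross terms in `s` and `t` produced by the input are exactly those with opposite sign in
  -- `f2`, produced by the noise `n₂`.
  have f1 : star (Bᴴ *ᵥ s + Eᴴ *ᵥ t) ⬝ᵥ R *ᵥ (Bᴴ *ᵥ s + Eᴴ *ᵥ t) =
      star (Bᴴ *ᵥ s) ⬝ᵥ R *ᵥ (Bᴴ *ᵥ s) + star s ⬝ᵥ (S₂ * Tᴴ) *ᵥ t +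
        (star t ⬝ᵥ (T * S₂) *ᵥ s + star t ⬝ᵥ (E * R * Eᴴ) *ᵥ t) := by
    rw [star_add, Matrix.mulVec_add, add_dotProduct, dotProduct_add, dotProduct_add,
      star_mulVec_dotProduct_mulVec B E, star_mulVec_dotProduct_mulVec E B,
      star_mulVec_dotProduct_mulVec E E, hT, hT']
  have f2 : star (s - Tᴴ *ᵥ t) ⬝ᵥ S₂ *ᵥ (s - Tᴴ *ᵥ t) =
      star s ⬝ᵥ S₂ *ᵥ s - star s ⬝ᵥ (S₂ * Tᴴ) *ᵥ t -
        (star t ⬝ᵥ (T * S₂) *ᵥ s - star t ⬝ᵥ (T * S₂ * Tᴴ) *ᵥ t) := by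
    rw [star_sub, Matrix.mulVec_sub, sub_dotProduct, dotProduct_sub, dotProduct_sub,
      star_mulVec_dotProduct_mulVec T T, Matrix.mulVec_mulVec, Matrix.star_mulVec,
      Matrix.conjTranspose_conjTranspose, ← Matrix.dotProduct_mulVec, Matrix.mulVec_mulVec]
  rw [f1, f2, Matrix.add_mulVec, Matrix.add_mulVec, dotProduct_add, dotProduct_add]
  ring

end CharFun

/-! ### Measurability of matrix operations. -/

section MatrixMeasurability

variable {m n k : Type*}

instance matrixBorelSpace [Countable m] [Countable n] : BorelSpace (Matrix m n ℂ) :=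
  inferInstanceAs (BorelSpace (m → n → ℂ))

instance matrixSecondCountableTopology [Countable m] [Countable n] :
    SecondCountableTopology (Matrix m n ℂ) :=
  inferInstanceAs (SecondCountableTopology (m → n → ℂ))

variable {γ : Type*} [MeasurableSpace γ] [Fintype m] [Fintype n] [Fintype k]

@[fun_prop]
theorem Measurable.matrix_mul {f : γ → Matrix m n ℂ} {g : γ → Matrix n k ℂ} (hf : Measurable f)
    (hg : Measurable g) : Measurable fun c => f c * g c :=
  (Continuous.measurable (f := fun p : Matrix m n ℂ × Matrix n k ℂ => p.1 * p.2)
    (by fun_prop)).comp (hf.prodMk hg)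

@[fun_prop]
theorem Measurable.matrix_mulVec {f : γ → Matrix m n ℂ} {g : γ → n → ℂ} (hf : Measurable f)
    (hg : Measurable g) : Measurable fun c => f c *ᵥ g c :=
  (Continuous.measurable (f := fun p : Matrix m n ℂ × (n → ℂ) => p.1 *ᵥ p.2)
    (by fun_prop)).comp (hf.prodMk hg)

@[fun_prop]
theorem Measurable.matrix_det [DecidableEq n] {f : γ → Matrix n n ℂ} (hf : Measurable f) :
    Measurable fun c => (f c).det :=
  (Continuous.measurable (f := fun p : Matrix n n ℂ => p.det) (by fun_prop)).comp hf

@[fun_prop]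
theorem Measurable.matrix_inv [DecidableEq n] {f : γ → Matrix n n ℂ} (hf : Measurable f) :
    Measurable fun c => (f c)⁻¹ := by
  simp_rw [Matrix.inv_def, Ring.inverse_eq_inv']
  exact (Continuous.measurable (f := fun p : ℂ × Matrix n n ℂ => p.1 • p.2) (by fun_prop)).comp
    (hf.matrix_det.inv.prodMk
      ((Continuous.measurable (f := fun p : Matrix n n ℂ => p.adjugate) (by fun_prop)).comp hf))

@[fun_prop]
theorem Measurable.matrix_conjTranspose {f : γ → Matrix m n ℂ} (hf : Measurable f) :
    Measurable fun c => (f c)ᴴ :=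
  (Continuous.measurable (f := fun p : Matrix m n ℂ => pᴴ) (by fun_prop)).comp hf

@[fun_prop]
theorem Measurable.matrix_add {f g : γ → Matrix m n ℂ} (hf : Measurable f) (hg : Measurable g) :
    Measurable fun c => f c + g c :=
  (Continuous.measurable (f := fun p : Matrix m n ℂ × Matrix m n ℂ => p.1 + p.2)
    (by fun_prop)).comp (hf.prodMk hg)

@[fun_prop]
theorem Measurable.matrix_sub {f g : γ → Matrix m n ℂ} (hf : Measurable f) (hg : Measurable g) :
    Measurable fun c => f c - g c :=
  (Continuous.measurable (f := fun p : Matrix m n ℂ × Matrix m n ℂ => p.1 - p.2)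
    (by fun_prop)).comp (hf.prodMk hg)

@[fun_prop]
theorem Measurable.matrix_const_smul {f : γ → Matrix m n ℂ} (hf : Measurable f) (r : ℂ) :
    Measurable fun c => r • f c :=
  (Continuous.measurable (f := fun p : Matrix m n ℂ => r • p) (by fun_prop)).comp hf

@[fun_prop]
theorem Measurable.matrix_trace {f : γ → Matrix n n ℂ} (hf : Measurable f) :
    Measurable fun c => (f c).trace :=
  (Continuous.measurable (f := fun p : Matrix n n ℂ => p.trace) (by fun_prop)).comp hf

@[fun_prop]
theorem Measurable.invQuadForm {N : ℕ} {S : γ → Matrix (Fin N) (Fin N) ℂ} {u : γ → Fin N → ℂ}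
    (hS : Measurable S) (hu : Measurable u) : Measurable fun c => invQuadForm (S c) (u c) :=
  (Continuous.measurable
    (f := fun p : Matrix (Fin N) (Fin N) ℂ × (Fin N → ℂ) => (star p.2 ⬝ᵥ p.1 *ᵥ p.2).re)
    (by fun_prop)).comp (hS.matrix_inv.prodMk hu)

end MatrixMeasurability

/-! ### Gaussian laws as kernels in their parameters. -/

section GaussianKernel

variable {γ : Type*} [MeasurableSpace γ] {N : ℕ}

/-- The Gaussian kernel with mean `m c` and covariance `S c`. -/
noncomputable def gaussianKernel (S : γ → Matrix (Fin N) (Fin N) ℂ) (m : γ → Fin N → ℂ)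
    (hS : Measurable S) (hm : Measurable m) (hpos : ∀ c, (S c).PosDef) :
    Kernel γ (Fin N → ℂ) where
  toFun c := shiftedGaussian (S c) (m c)
  measurable' := by
    refine Measure.measurable_of_measurable_coe _ fun s hs => ?_
    -- Passing to the density avoids the measurability of the matrix square root in `c`.
    have h : ∀ c, shiftedGaussian (S c) (m c) s =
        ∫⁻ y in s, ENNReal.ofReal (complexGaussianDensity (S c) (m c) y) := fun c => by
      rw [shiftedGaussian_eq_withDensity (hpos c), withDensity_apply _ hs]
    simp_rw [h]
    refine Measurable.lintegral_prod_right' (f := fun p : γ × (Fin N → ℂ) =>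
      ENNReal.ofReal (complexGaussianDensity (S p.1) (m p.1) p.2)) ?_
    have hq : Measurable fun p : γ × (Fin N → ℂ) => invQuadForm (S p.1) (p.2 - m p.1) :=
      Measurable.invQuadForm (hS.comp measurable_fst)
        (measurable_snd.sub (hm.comp measurable_fst))
    have hd : Measurable fun p : γ × (Fin N → ℂ) => (S p.1).det :=
      (hS.comp measurable_fst).matrix_det
    unfold complexGaussianDensity
    fun_prop

theorem gaussianKernel_apply (S : γ → Matrix (Fin N) (Fin N) ℂ) (m : γ → Fin N → ℂ)
    (hS : Measurable S) (hm : Measurable m) (hpos : ∀ c, (S c).PosDef) (c : γ) :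
    gaussianKernel S m hS hm hpos c = shiftedGaussian (S c) (m c) := rfl

instance (S : γ → Matrix (Fin N) (Fin N) ℂ) (m : γ → Fin N → ℂ)
    (hS : Measurable S) (hm : Measurable m) (hpos : ∀ c, (S c).PosDef) :
    IsMarkovKernel (gaussianKernel S m hS hm hpos) :=
  ⟨fun c => by rw [gaussianKernel_apply]; infer_instance⟩

end GaussianKernel

/-! ### Log-determinant inequalities. -/

section LogDet

variable {N : ℕ} {S R : Matrix (Fin N) (Fin N) ℂ}

/-- The trace in `gaussianDivergence S (S + R)` is `N - tr((S + R)⁻¹ R)`. -/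
theorem log_det_add_sub (hS : S.PosDef) (hR : R.PosSemidef) :
    Real.log (S + R).det.re - Real.log S.det.re =
      gaussianDivergence S (S + R) + ((S + R)⁻¹ * R).trace.re := by
  have h := trace_inv_mul_self (hS.add_posSemidef hR)
  rw [Matrix.mul_add, Matrix.trace_add, Complex.add_re] at h
  rw [gaussianDivergence]
  linarith

theorem log_det_add_sub_nonneg (hS : S.PosDef) (hR : R.PosSemidef) :
    0 ≤ Real.log (S + R).det.re - Real.log S.det.re := by
  have hSR := hS.add_posSemidef hR
  rw [log_det_add_sub hS hR]
  exact add_nonneg (gaussianDivergence_nonneg hS hSR) (re_trace_mul_inv_nonneg hSR.posSemidef hR)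

/-- The divergence from the identity covariance is nonnegative. This later turns second moments into
integrability of log-determinants. -/
theorem log_det_le_trace (hS : S.PosDef) : Real.log S.det.re ≤ S.trace.re := by
  have h := gaussianDivergence_nonneg hS (Matrix.PosDef.one (n := Fin N) (R := ℂ))
  simp only [gaussianDivergence, Matrix.det_one, Complex.one_re, Real.log_one, inv_one,
    Matrix.one_mul] at h
  have : (0 : ℝ) ≤ N := N.cast_nonneg
  linarith

end LogDet

/-! ### The LMMSE estimator, its error covariance and the determinant identity. -/

section Estimator

variable {M N₁ N₂ : ℕ} {S₁ : Matrix (Fin N₁) (Fin N₁) ℂ} {S₂ : Matrix (Fin N₂) (Fin N₂) ℂ}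
  {ρ : ℝ} (A : Matrix (Fin N₁) (Fin M) ℂ) (B : Matrix (Fin N₂) (Fin M) ℂ)

/-- The covariance of the observation `B x + n₂` for an input `x` of covariance `ρ I`. -/
noncomputable def observationCov (S₂ : Matrix (Fin N₂) (Fin N₂) ℂ) (ρ : ℝ)
    (B : Matrix (Fin N₂) (Fin M) ℂ) : Matrix (Fin N₂) (Fin N₂) ℂ :=
  S₂ + (ρ : ℂ) • (B * Bᴴ)

/-- The linear minimum mean square error estimator of `A x` from `B x + n₂`. -/
noncomputable def lmmse (S₂ : Matrix (Fin N₂) (Fin N₂) ℂ) (ρ : ℝ)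
    (A : Matrix (Fin N₁) (Fin M) ℂ) (B : Matrix (Fin N₂) (Fin M) ℂ) :
    Matrix (Fin N₁) (Fin N₂) ℂ :=
  ((ρ : ℂ) • (A * Bᴴ)) * (observationCov S₂ ρ B)⁻¹

/-- The covariance of the estimation error `A x + n₁ - T (B x + n₂)` of the estimator `T`. -/
noncomputable def errorCov (S₁ : Matrix (Fin N₁) (Fin N₁) ℂ) (S₂ : Matrix (Fin N₂) (Fin N₂) ℂ)
    (ρ : ℝ) (A : Matrix (Fin N₁) (Fin M) ℂ) (B : Matrix (Fin N₂) (Fin M) ℂ) :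
    Matrix (Fin N₁) (Fin N₁) ℂ :=
  S₁ + lmmse S₂ ρ A B * S₂ * (lmmse S₂ ρ A B)ᴴ +
    (A - lmmse S₂ ρ A B * B) * ((ρ : ℂ) • (1 : Matrix (Fin M) (Fin M) ℂ)) * (A - lmmse S₂ ρ A B * B)ᴴ

theorem posSemidef_ofReal_smul {n : Type*} [Fintype n] {R : Matrix n n ℂ} (hρ : 0 ≤ ρ)
    (hR : R.PosSemidef) : ((ρ : ℂ) • R).PosSemidef :=
  hR.smul (Complex.zero_le_real.mpr hρ)

theorem observationCov_posDef (hS₂ : S₂.PosDef) (hρ : 0 ≤ ρ) : (observationCov S₂ ρ B).PosDef :=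
  hS₂.add_posSemidef (posSemidef_ofReal_smul hρ (Matrix.posSemidef_self_mul_conjTranspose B))

theorem errorCov_posDef (hS₁ : S₁.PosDef) (hS₂ : S₂.PosDef) (hρ : 0 ≤ ρ) :
    (errorCov S₁ S₂ ρ A B).PosDef :=
  (hS₁.add_posSemidef (hS₂.posSemidef.mul_mul_conjTranspose_same _)).add_posSemidef
    ((posSemidef_ofReal_smul hρ Matrix.PosSemidef.one).mul_mul_conjTranspose_same _)

theorem lmmse_mul_observationCov (hS₂ : S₂.PosDef) (hρ : 0 ≤ ρ) :
    lmmse S₂ ρ A B * observationCov S₂ ρ B = (ρ : ℂ) • (A * Bᴴ) := by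
  rw [lmmse, Matrix.mul_assoc, Matrix.nonsing_inv_mul _
    (isUnit_iff_ne_zero.mpr (observationCov_posDef B hS₂ hρ).det_pos.ne'), Matrix.mul_one]

/-- The orthogonality principle: the estimation error is uncorrelated with the observation. It is
the hypothesis `hT` of `map_observation_error_eq_prod`. -/
theorem sub_lmmse_mul_mul_conjTranspose (hS₂ : S₂.PosDef) (hρ : 0 ≤ ρ) :
    (A - lmmse S₂ ρ A B * B) * ((ρ : ℂ) • (1 : Matrix (Fin M) (Fin M) ℂ)) * Bᴴ =
      lmmse S₂ ρ A B * S₂ := by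
  have h := lmmse_mul_observationCov A B hS₂ hρ
  rw [observationCov, Matrix.mul_add] at h
  rw [Matrix.mul_smul, Matrix.mul_one, Matrix.smul_mul, Matrix.sub_mul, smul_sub, ← h,
    Matrix.mul_smul, Matrix.mul_assoc, add_sub_cancel_right]

/-- The definition makes positivity evident; this form is a Schur complement and involves the fading
only through Gram products, whence the invariance under unitaries. -/
theorem errorCov_eq (hS₂ : S₂.PosDef) (hρ : 0 ≤ ρ) :
    errorCov S₁ S₂ ρ A B =
      S₁ + (ρ : ℂ) • (A * Aᴴ) - lmmse S₂ ρ A B * ((ρ : ℂ) • (B * Aᴴ)) := by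
  have h := sub_lmmse_mul_mul_conjTranspose A B hS₂ hρ
  rw [errorCov, ← h]
  simp only [Matrix.conjTranspose_sub, Matrix.conjTranspose_mul, Matrix.mul_smul, Matrix.smul_mul,
    Matrix.mul_one, Matrix.mul_sub, Matrix.sub_mul, Matrix.mul_assoc]
  module

/-- Schur's formula for the lower right block: the complement of `observationCov` is the error
covariance. -/
theorem det_joint_eq (hS₂ : S₂.PosDef) (hρ : 0 ≤ ρ) :
    Matrix.det (Matrix.fromBlocks S₁ 0 0 S₂ +
      (ρ : ℂ) • (Matrix.fromRows A B * Matrix.fromCols Aᴴ Bᴴ)) =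
      (observationCov S₂ ρ B).det * (errorCov S₁ S₂ ρ A B).det := by
  have hu := isUnit_iff_ne_zero.mpr (observationCov_posDef B hS₂ hρ).det_pos.ne'
  have := Matrix.invertibleOfIsUnitDet (observationCov S₂ ρ B) hu
  rw [Matrix.fromRows_mul_fromCols, Matrix.fromBlocks_smul, Matrix.fromBlocks_add, zero_add,
    zero_add]
  change Matrix.det (Matrix.fromBlocks _ _ _ (observationCov S₂ ρ B)) = _
  rw [Matrix.det_fromBlocks₂₂, Matrix.invOf_eq_nonsing_inv, errorCov_eq A B hS₂ hρ]
  rfl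

section Unitary

variable {Q : Matrix (Fin M) (Fin M) ℂ}

theorem mul_unitary_mul_conjTranspose {m k : Type*} (hQ : Q ∈ Matrix.unitaryGroup (Fin M) ℂ)
    (F : Matrix m (Fin M) ℂ) (G : Matrix k (Fin M) ℂ) : F * Q * (G * Q)ᴴ = F * Gᴴ := by
  have h : Q * Qᴴ = 1 := Matrix.mem_unitaryGroup_iff.mp hQ
  rw [Matrix.conjTranspose_mul, Matrix.mul_assoc, ← Matrix.mul_assoc Q, h, Matrix.one_mul]

theorem lmmse_mul_unitary (hQ : Q ∈ Matrix.unitaryGroup (Fin M) ℂ) :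
    lmmse S₂ ρ (A * Q) (B * Q) = lmmse S₂ ρ A B := by
  simp only [lmmse, observationCov, mul_unitary_mul_conjTranspose hQ]

theorem errorCov_mul_unitary (hS₂ : S₂.PosDef) (hρ : 0 ≤ ρ)
    (hQ : Q ∈ Matrix.unitaryGroup (Fin M) ℂ) :
    errorCov S₁ S₂ ρ (A * Q) (B * Q) = errorCov S₁ S₂ ρ A B := by
  rw [errorCov_eq _ _ hS₂ hρ, errorCov_eq _ _ hS₂ hρ, lmmse_mul_unitary A B hQ,
    mul_unitary_mul_conjTranspose hQ, mul_unitary_mul_conjTranspose hQ]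

end Unitary

/-- The part of the mean divergence that does not depend on the input. -/
noncomputable def baseDivergence (S₁ : Matrix (Fin N₁) (Fin N₁) ℂ)
    (S₂ : Matrix (Fin N₂) (Fin N₂) ℂ)
    (ρ : ℝ) (A : Matrix (Fin N₁) (Fin M) ℂ) (B : Matrix (Fin N₂) (Fin M) ℂ) : ℝ≥0∞ :=
  ENNReal.ofReal (gaussianDivergence S₁ (errorCov S₁ S₂ ρ A B)) +
    ENNReal.ofReal ((errorCov S₁ S₂ ρ A B)⁻¹ *
      (lmmse S₂ ρ A B * S₂ * (lmmse S₂ ρ A B)ᴴ)).trace.re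

/-- The part of the mean divergence that is quadratic in the input. -/
noncomputable def inputDivergence (S₁ : Matrix (Fin N₁) (Fin N₁) ℂ)
    (S₂ : Matrix (Fin N₂) (Fin N₂) ℂ)
    (ρ : ℝ) (A : Matrix (Fin N₁) (Fin M) ℂ) (B : Matrix (Fin N₂) (Fin M) ℂ) (x : Fin M → ℂ) :
    ℝ≥0∞ :=
  ENNReal.ofReal (invQuadForm (errorCov S₁ S₂ ρ A B) ((A - lmmse S₂ ρ A B * B) *ᵥ x))

theorem lintegral_klDiv_observation (hS₁ : S₁.PosDef) (hS₂ : S₂.PosDef) (hρ : 0 ≤ ρ)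
    (x : Fin M → ℂ) :
    ∫⁻ n, InformationTheory.klDiv (shiftedGaussian S₁ (A *ᵥ x))
        (shiftedGaussian (errorCov S₁ S₂ ρ A B) (lmmse S₂ ρ A B *ᵥ (B *ᵥ x + n)))
        ∂(complexGaussian S₂) =
      baseDivergence S₁ S₂ ρ A B + inputDivergence S₁ S₂ ρ A B x := by
  have hC := errorCov_posDef A B hS₁ hS₂ hρ
  simp_rw [klDiv_shiftedGaussian hS₁ hC]
  rw [lintegral_add_left measurable_const, lintegral_const, measure_univ, mul_one]
  -- The distance between the means is a noise part plus an input part. The noise is centred, so the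
  -- two contribute separately.
  have h : ∀ n, A *ᵥ x - lmmse S₂ ρ A B *ᵥ (B *ᵥ x + n) =
      (-lmmse S₂ ρ A B) *ᵥ n + (A - lmmse S₂ ρ A B * B) *ᵥ x := by
    intro n
    rw [Matrix.mulVec_add, Matrix.sub_mulVec, Matrix.neg_mulVec, ← Matrix.mulVec_mulVec]
    abel
  simp_rw [h]
  rw [lintegral_invQuadForm_mulVec_add hC.posSemidef hS₂.posSemidef, Matrix.conjTranspose_neg,
    Matrix.neg_mul, Matrix.neg_mul, Matrix.mul_neg (_ * _), neg_neg, baseDivergence,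
    inputDivergence, add_assoc]

theorem lintegral_inputDivergence (hS₁ : S₁.PosDef) (hS₂ : S₂.PosDef) (hρ : 0 ≤ ρ) :
    ∫⁻ x, inputDivergence S₁ S₂ ρ A B x
        ∂(complexGaussian ((ρ : ℂ) • (1 : Matrix (Fin M) (Fin M) ℂ))) =
      ENNReal.ofReal ((errorCov S₁ S₂ ρ A B)⁻¹ * ((A - lmmse S₂ ρ A B * B) *
        ((ρ : ℂ) • (1 : Matrix (Fin M) (Fin M) ℂ)) *
        (A - lmmse S₂ ρ A B * B)ᴴ)).trace.re := by
  have hC := errorCov_posDef A B hS₁ hS₂ hρ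
  have h := lintegral_invQuadForm_mulVec_add hC.posSemidef
    (posSemidef_ofReal_smul hρ Matrix.PosSemidef.one) (A - lmmse S₂ ρ A B * B) 0
  simpa only [inputDivergence, add_zero, invQuadForm_zero, ENNReal.ofReal_zero] using h

/-- The noise and input traces add up to `tr(C⁻¹ (C - S₁))`, which by `log_det_add_sub` cancels
against the divergence of `S₁` from `C`. -/
theorem baseDivergence_add_lintegral_inputDivergence (hS₁ : S₁.PosDef) (hS₂ : S₂.PosDef)
    (hρ : 0 ≤ ρ) :
    baseDivergence S₁ S₂ ρ A B +
        ∫⁻ x, inputDivergence S₁ S₂ ρ A B x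
        ∂(complexGaussian ((ρ : ℂ) • (1 : Matrix (Fin M) (Fin M) ℂ))) =
      ENNReal.ofReal (Real.log (errorCov S₁ S₂ ρ A B).det.re - Real.log S₁.det.re) := by
  have hC := errorCov_posDef A B hS₁ hS₂ hρ
  have h1 := hS₂.posSemidef.mul_mul_conjTranspose_same (lmmse S₂ ρ A B)
  have h2 := (posSemidef_ofReal_smul hρ Matrix.PosSemidef.one).mul_mul_conjTranspose_same
    (A - lmmse S₂ ρ A B * B)
  have h3 := re_trace_mul_inv_nonneg hC.posSemidef h1
  have h4 := re_trace_mul_inv_nonneg hC.posSemidef h2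
  have h5 := gaussianDivergence_nonneg hS₁ hC
  rw [lintegral_inputDivergence A B hS₁ hS₂ hρ, baseDivergence, ← ENNReal.ofReal_add h5 h3,
    ← ENNReal.ofReal_add (add_nonneg h5 h3) h4]
  congr 1
  have h6 := log_det_add_sub hS₁ (h1.add h2)
  rw [← add_assoc, ← errorCov, Matrix.mul_add, Matrix.trace_add, Complex.add_re] at h6
  rw [h6, add_assoc]

theorem log_det_errorCov_sub_nonneg (hS₁ : S₁.PosDef) (hS₂ : S₂.PosDef) (hρ : 0 ≤ ρ) :
    0 ≤ Real.log (errorCov S₁ S₂ ρ A B).det.re - Real.log S₁.det.re := by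
  rw [errorCov, add_assoc]
  exact log_det_add_sub_nonneg hS₁ ((hS₂.posSemidef.mul_mul_conjTranspose_same _).add
    ((posSemidef_ofReal_smul hρ Matrix.PosSemidef.one).mul_mul_conjTranspose_same _))

theorem logDetJoint_eq (hS₁ : S₁.PosDef) (hS₂ : S₂.PosDef) (hρ : 0 ≤ ρ) :
    logDetJoint S₁ S₂ ρ A B = (Real.log (observationCov S₂ ρ B).det.re +
      Real.log (errorCov S₁ S₂ ρ A B).det.re) / Real.log 2 := by
  have hD := observationCov_posDef B hS₂ hρ
  have hC := errorCov_posDef A B hS₁ hS₂ hρ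
  rw [logDetJoint, det_joint_eq A B hS₂ hρ, Complex.mul_re, det_im_eq_zero hD, zero_mul, sub_zero,
    Real.logb, Real.log_mul (det_re_pos hD).ne' (det_re_pos hC).ne']

theorem logDetSide_eq (hS₁ : S₁.PosDef) (hS₂ : S₂.PosDef) (hρ : 0 ≤ ρ) :
    logDetSide S₁ S₂ ρ B = (Real.log (observationCov S₂ ρ B).det.re +
      Real.log S₁.det.re) / Real.log 2 := by
  have hD := observationCov_posDef B hS₂ hρ
  rw [logDetSide, ← observationCov, Complex.mul_re, det_im_eq_zero hD, zero_mul, sub_zero,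
    Real.logb, Real.log_mul (det_re_pos hD).ne' (det_re_pos hS₁).ne']

end Estimator

/-! ### The reference kernel and the channel kernel. -/

section EstimatorKernels

open InformationTheory

variable {M N₁ N₂ : ℕ} {S₁ : Matrix (Fin N₁) (Fin N₁) ℂ} {S₂ : Matrix (Fin N₂) (Fin N₂) ℂ} {ρ : ℝ}

/-- The side information `(z, a, b)`: an output of the second channel and the fading matrices. -/
abbrev SideInfo (M N₁ N₂ : ℕ) : Type :=
  (Fin N₂ → ℂ) × Matrix (Fin N₁) (Fin M) ℂ × Matrix (Fin N₂) (Fin M) ℂ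

section Measurability

variable {γ : Type*} [MeasurableSpace γ] {f : γ → Matrix (Fin N₁) (Fin M) ℂ}
  {g : γ → Matrix (Fin N₂) (Fin M) ℂ}

@[fun_prop]
theorem Measurable.observationCov (S₂ : Matrix (Fin N₂) (Fin N₂) ℂ) (ρ : ℝ) (hg : Measurable g) :
    Measurable fun c => observationCov S₂ ρ (g c) :=
  measurable_const.matrix_add ((hg.matrix_mul hg.matrix_conjTranspose).matrix_const_smul _)

@[fun_prop]
theorem Measurable.lmmse (S₂ : Matrix (Fin N₂) (Fin N₂) ℂ) (ρ : ℝ) (hf : Measurable f)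
    (hg : Measurable g) : Measurable fun c => lmmse S₂ ρ (f c) (g c) :=
  ((hf.matrix_mul hg.matrix_conjTranspose).matrix_const_smul _).matrix_mul
    (hg.observationCov S₂ ρ).matrix_inv

@[fun_prop]
theorem Measurable.errorCov (S₁ : Matrix (Fin N₁) (Fin N₁) ℂ) (S₂ : Matrix (Fin N₂) (Fin N₂) ℂ)
    (ρ : ℝ) (hf : Measurable f) (hg : Measurable g) :
    Measurable fun c => errorCov S₁ S₂ ρ (f c) (g c) := by
  have hT := hf.lmmse S₂ ρ hg
  have hE := hf.matrix_sub (hT.matrix_mul hg)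
  exact (measurable_const.matrix_add
    ((hT.matrix_mul measurable_const).matrix_mul hT.matrix_conjTranspose)).matrix_add
    ((hE.matrix_mul measurable_const).matrix_mul hE.matrix_conjTranspose)

@[fun_prop]
theorem Measurable.gaussianDivergence {C : γ → Matrix (Fin N₁) (Fin N₁) ℂ}
    (S₁ : Matrix (Fin N₁) (Fin N₁) ℂ) (hC : Measurable C) :
    Measurable fun c => gaussianDivergence S₁ (C c) := by
  have h1 := hC.matrix_det
  have h2 := (hC.matrix_inv.matrix_mul (measurable_const (a := S₁))).matrix_trace
  unfold _root_.gaussianDivergence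
  fun_prop

@[fun_prop]
theorem Measurable.baseDivergence (S₁ : Matrix (Fin N₁) (Fin N₁) ℂ)
    (S₂ : Matrix (Fin N₂) (Fin N₂) ℂ) (ρ : ℝ) (hf : Measurable f) (hg : Measurable g) :
    Measurable fun c => baseDivergence S₁ S₂ ρ (f c) (g c) := by
  unfold _root_.baseDivergence
  fun_prop

@[fun_prop]
theorem Measurable.inputDivergence (S₁ : Matrix (Fin N₁) (Fin N₁) ℂ)
    (S₂ : Matrix (Fin N₂) (Fin N₂) ℂ) (ρ : ℝ) {x : γ → Fin M → ℂ} (hf : Measurable f)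
    (hg : Measurable g) (hx : Measurable x) :
    Measurable fun c => inputDivergence S₁ S₂ ρ (f c) (g c) (x c) := by
  unfold _root_.inputDivergence
  fun_prop

end Measurability

/-- The conditional law of the first output given the side information, for a Gaussian input of
covariance `ρ I`. -/
noncomputable def estimatorKernel (M : ℕ) (hS₁ : S₁.PosDef) (hS₂ : S₂.PosDef) (hρ : 0 ≤ ρ) :
    Kernel (SideInfo M N₁ N₂) (Fin N₁ → ℂ) :=
  gaussianKernel (fun v => errorCov S₁ S₂ ρ v.2.1 v.2.2) (fun v => lmmse S₂ ρ v.2.1 v.2.2 *ᵥ v.1)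
    (by fun_prop) (by fun_prop) fun v => errorCov_posDef v.2.1 v.2.2 hS₁ hS₂ hρ

/-- The conditional law of the first output given the side information and the input. -/
noncomputable def outputKernel (M N₂ : ℕ) (hS₁ : S₁.PosDef) :
    Kernel (SideInfo M N₁ N₂ × (Fin M → ℂ)) (Fin N₁ → ℂ) :=
  gaussianKernel (fun _ => S₁) (fun p => p.1.2.1 *ᵥ p.2) (by fun_prop) (by fun_prop) fun _ => hS₁

instance (hS₁ : S₁.PosDef) (hS₂ : S₂.PosDef) (hρ : 0 ≤ ρ) :
    IsMarkovKernel (estimatorKernel M hS₁ hS₂ hρ) := by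
  unfold estimatorKernel; infer_instance

instance (hS₁ : S₁.PosDef) : IsMarkovKernel (outputKernel M N₂ hS₁) := by
  unfold outputKernel; infer_instance

theorem estimatorKernel_apply (hS₁ : S₁.PosDef) (hS₂ : S₂.PosDef) (hρ : 0 ≤ ρ)
    (v : SideInfo M N₁ N₂) : estimatorKernel M hS₁ hS₂ hρ v =
      shiftedGaussian (errorCov S₁ S₂ ρ v.2.1 v.2.2) (lmmse S₂ ρ v.2.1 v.2.2 *ᵥ v.1) := rfl

theorem outputKernel_apply (hS₁ : S₁.PosDef) (p : SideInfo M N₁ N₂ × (Fin M → ℂ)) :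
    outputKernel M N₂ hS₁ p = shiftedGaussian S₁ (p.1.2.1 *ᵥ p.2) := rfl

theorem outputKernel_absolutelyContinuous (hS₁ : S₁.PosDef) (hS₂ : S₂.PosDef) (hρ : 0 ≤ ρ)
    (p : SideInfo M N₁ N₂ × (Fin M → ℂ)) :
    outputKernel M N₂ hS₁ p ≪ estimatorKernel M hS₁ hS₂ hρ p.1 :=
  shiftedGaussian_absolutelyContinuous hS₁ (errorCov_posDef _ _ hS₁ hS₂ hρ) _ _

theorem klDiv_outputKernel_ne_top (hS₁ : S₁.PosDef) (hS₂ : S₂.PosDef) (hρ : 0 ≤ ρ)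
    (p : SideInfo M N₁ N₂ × (Fin M → ℂ)) :
    klDiv (outputKernel M N₂ hS₁ p) (estimatorKernel M hS₁ hS₂ hρ p.1) ≠ ∞ :=
  klDiv_ne_top (outputKernel_absolutelyContinuous hS₁ hS₂ hρ p)
    (integrable_llr_shiftedGaussian hS₁ (errorCov_posDef _ _ hS₁ hS₂ hρ) _ _)

theorem measurable_klDiv_outputKernel (hS₁ : S₁.PosDef) (hS₂ : S₂.PosDef) (hρ : 0 ≤ ρ) :
    Measurable fun p : SideInfo M N₁ N₂ × (Fin M → ℂ) =>
      klDiv (outputKernel M N₂ hS₁ p) (estimatorKernel M hS₁ hS₂ hρ p.1) := by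
  simp_rw [outputKernel_apply, estimatorKernel_apply,
    klDiv_shiftedGaussian hS₁ (errorCov_posDef _ _ hS₁ hS₂ hρ)]
  fun_prop

end EstimatorKernels

/-! ### Output laws on the canonical space of fading and noise, and the mean divergence. -/

section Canonical

open InformationTheory

variable {M N₁ N₂ : ℕ} {S₁ : Matrix (Fin N₁) (Fin N₁) ℂ} {S₂ : Matrix (Fin N₂) (Fin N₂) ℂ} {ρ : ℝ}

/-- The joint law of the fading, of law `π`, and the noise. -/
noncomputable def fadingNoiseLaw
    (π : Measure (Matrix (Fin N₁) (Fin M) ℂ × Matrix (Fin N₂) (Fin M) ℂ))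
    (S₁ : Matrix (Fin N₁) (Fin N₁) ℂ) (S₂ : Matrix (Fin N₂) (Fin N₂) ℂ) :
    Measure ((Matrix (Fin N₁) (Fin M) ℂ × Matrix (Fin N₂) (Fin M) ℂ) ×
      ((Fin N₁ → ℂ) × (Fin N₂ → ℂ))) :=
  π.prod ((complexGaussian S₁).prod (complexGaussian S₂))

/-- The side information for the input `x`, the fading and the noise. -/
def sideOutput (x : Fin M → ℂ) (h : (Matrix (Fin N₁) (Fin M) ℂ × Matrix (Fin N₂) (Fin M) ℂ) ×
    ((Fin N₁ → ℂ) × (Fin N₂ → ℂ))) : SideInfo M N₁ N₂ :=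
  (h.1.2 *ᵥ x + h.2.2, h.1.1, h.1.2)

/-- The first output for the input `x`, the fading and the noise. -/
def mainOutput (x : Fin M → ℂ) (h : (Matrix (Fin N₁) (Fin M) ℂ × Matrix (Fin N₂) (Fin M) ℂ) ×
    ((Fin N₁ → ℂ) × (Fin N₂ → ℂ))) : Fin N₁ → ℂ :=
  h.1.1 *ᵥ x + h.2.1

variable {γ : Type*} [MeasurableSpace γ]

@[fun_prop]
theorem Measurable.sideOutput {x : γ → Fin M → ℂ}
    {h : γ → (Matrix (Fin N₁) (Fin M) ℂ × Matrix (Fin N₂) (Fin M) ℂ) ×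
      ((Fin N₁ → ℂ) × (Fin N₂ → ℂ))} (hx : Measurable x) (hh : Measurable h) :
    Measurable fun c => sideOutput (x c) (h c) := by
  unfold _root_.sideOutput; fun_prop

@[fun_prop]
theorem Measurable.mainOutput {x : γ → Fin M → ℂ}
    {h : γ → (Matrix (Fin N₁) (Fin M) ℂ × Matrix (Fin N₂) (Fin M) ℂ) ×
      ((Fin N₁ → ℂ) × (Fin N₂ → ℂ))} (hx : Measurable x) (hh : Measurable h) :
    Measurable fun c => mainOutput (x c) (h c) := by
  unfold _root_.mainOutput; fun_prop

variable (π : Measure (Matrix (Fin N₁) (Fin M) ℂ × Matrix (Fin N₂) (Fin M) ℂ))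

instance [IsProbabilityMeasure π] : IsProbabilityMeasure (fadingNoiseLaw π S₁ S₂) := by
  unfold fadingNoiseLaw; infer_instance

theorem lintegral_shiftedGaussian {N : ℕ} (S : Matrix (Fin N) (Fin N) ℂ) (m : Fin N → ℂ)
    {f : (Fin N → ℂ) → ℝ≥0∞} (hf : Measurable f) :
    ∫⁻ y, f y ∂(shiftedGaussian S m) = ∫⁻ u, f (m + u) ∂(complexGaussian S) :=
  lintegral_map hf (by fun_prop)

/-- Given the input and the side information, the first output has the law `outputKernel`. -/
theorem lintegral_fadingNoiseLaw_output (hS₁ : S₁.PosDef) (x : Fin M → ℂ)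
    {f : SideInfo M N₁ N₂ × (Fin N₁ → ℂ) → ℝ≥0∞} (hf : Measurable f) :
    ∫⁻ h, f (sideOutput x h, mainOutput x h) ∂(fadingNoiseLaw π S₁ S₂) =
      ∫⁻ h, ∫⁻ y, f (sideOutput x h, y) ∂(outputKernel M N₂ hS₁ (sideOutput x h, x))
        ∂(fadingNoiseLaw π S₁ S₂) := by
  have hm : ∀ s : SideInfo M N₁ N₂, Measurable fun y => f (s, y) := fun s => by fun_prop
  simp_rw [outputKernel_apply, lintegral_shiftedGaussian _ _ (hm _)]
  have hK : Measurable fun h : (Matrix (Fin N₁) (Fin M) ℂ × Matrix (Fin N₂) (Fin M) ℂ) ×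
      ((Fin N₁ → ℂ) × (Fin N₂ → ℂ)) =>
      ∫⁻ u, f (sideOutput x h, (sideOutput x h).2.1 *ᵥ x + u) ∂(complexGaussian S₁) := by
    refine Measurable.lintegral_prod_right' (f := fun p : ((Matrix (Fin N₁) (Fin M) ℂ ×
      Matrix (Fin N₂) (Fin M) ℂ) × ((Fin N₁ → ℂ) × (Fin N₂ → ℂ))) × (Fin N₁ → ℂ) =>
      f (sideOutput x p.1, (sideOutput x p.1).2.1 *ᵥ x + p.2)) ?_
    fun_prop
  rw [fadingNoiseLaw, lintegral_prod _ (by fun_prop), lintegral_prod _ hK.aemeasurable]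
  refine lintegral_congr fun h => ?_
  rw [lintegral_prod_symm _ (by fun_prop), lintegral_prod_symm _ (by fun_prop)]
  simp only [sideOutput, mainOutput, lintegral_const, measure_univ, mul_one]

/-- For fixed fading, the first output is `T z` plus an error independent of the observation `z`, so
its law given `z` is the shifted error law. -/
theorem lintegral_gaussian_observation (hS₁ : S₁.PosDef) (hS₂ : S₂.PosDef) (hρ : 0 ≤ ρ)
    {f : SideInfo M N₁ N₂ × (Fin N₁ → ℂ) → ℝ≥0∞} (hf : Measurable f)
    (a : Matrix (Fin N₁) (Fin M) ℂ) (b : Matrix (Fin N₂) (Fin M) ℂ) :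
    ∫⁻ x, ∫⁻ n, f (sideOutput x ((a, b), n), mainOutput x ((a, b), n))
        ∂((complexGaussian S₁).prod (complexGaussian S₂))
        ∂(complexGaussian ((ρ : ℂ) • (1 : Matrix (Fin M) (Fin M) ℂ))) =
      ∫⁻ x, ∫⁻ n, ∫⁻ y, f (sideOutput x ((a, b), n), y)
        ∂(estimatorKernel M hS₁ hS₂ hρ (sideOutput x ((a, b), n)))
        ∂((complexGaussian S₁).prod (complexGaussian S₂))
        ∂(complexGaussian ((ρ : ℂ) • (1 : Matrix (Fin M) (Fin M) ℂ))) := by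
  have hR : ((ρ : ℂ) • (1 : Matrix (Fin M) (Fin M) ℂ)).PosSemidef :=
    posSemidef_ofReal_smul hρ Matrix.PosSemidef.one
  have hK : Measurable fun s : SideInfo M N₁ N₂ =>
      ∫⁻ y, f (s, y) ∂(estimatorKernel M hS₁ hS₂ hρ s) := hf.lintegral_kernel_prod_right'
  have h := map_observation_error_eq_prod hR hS₁.posSemidef hS₂.posSemidef a b (lmmse S₂ ρ a b)
    (sub_lmmse_mul_mul_conjTranspose a b hS₂ hρ)
  rw [← errorCov] at h
  set G := complexGaussian ((ρ : ℂ) • (1 : Matrix (Fin M) (Fin M) ℂ)) with hG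
  have mB : Measurable fun p : (Fin M → ℂ) × (Fin N₂ → ℂ) => b *ᵥ p.1 + p.2 := by fun_prop
  have mφ : Measurable fun p : (Fin M → ℂ) × (Fin N₁ → ℂ) × (Fin N₂ → ℂ) =>
    (b *ᵥ p.1 + p.2.2, a *ᵥ p.1 + p.2.1 - lmmse S₂ ρ a b *ᵥ (b *ᵥ p.1 + p.2.2)) := by fun_prop
  have := Measure.isProbabilityMeasure_map (μ := G.prod (complexGaussian S₂)) mB.aemeasurable
  have mF : Measurable fun q : (Fin N₂ → ℂ) × (Fin N₁ → ℂ) =>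
    f ((q.1, a, b), lmmse S₂ ρ a b *ᵥ q.1 + q.2) := by fun_prop
  -- The independence identity is tested on `f` with the output rebuilt from observation and error.
  have h' := congrArg (fun ξ => ∫⁻ q, f ((q.1, a, b), lmmse S₂ ρ a b *ᵥ q.1 + q.2) ∂ξ) h
  beta_reduce at h'
  rw [lintegral_map mF mφ, lintegral_prod _ mF.aemeasurable, lintegral_map
    mF.lintegral_prod_right' mB, lintegral_prod _ (by fun_prop),
    lintegral_prod _ (by exact (mF.lintegral_prod_right'.comp mB).aemeasurable)] at h'
  dsimp only at h'
  simp only [add_sub_cancel] at h'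
  refine Eq.trans h' (lintegral_congr fun x => ?_)
  have mn : Measurable fun n : (Fin N₁ → ℂ) × (Fin N₂ → ℂ) =>
      ∫⁻ y, f (sideOutput x ((a, b), n), y)
        ∂(estimatorKernel M hS₁ hS₂ hρ (sideOutput x ((a, b), n))) := hK.comp (by fun_prop)
  rw [lintegral_prod_symm _ mn.aemeasurable]
  have hm : ∀ s : SideInfo M N₁ N₂, Measurable fun y => f (s, y) := fun s => by fun_prop
  simp only [sideOutput, lintegral_const, measure_univ, mul_one, estimatorKernel_apply,
    lintegral_shiftedGaussian _ _ (hm _)]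

/-- The identity for fixed fading holds only after averaging over the input, so the fading integral
has to be moved outside. -/
theorem lintegral_lintegral_congr_swap {α β : Type*} [MeasurableSpace α] [MeasurableSpace β]
    {μ : Measure α} {ν : Measure β} [SFinite μ] [SFinite ν] {F G : α × β → ℝ≥0∞}
    (hF : Measurable F) (hG : Measurable G)
    (h : ∀ b, ∫⁻ a, F (a, b) ∂μ = ∫⁻ a, G (a, b) ∂μ) :
    ∫⁻ a, ∫⁻ b, F (a, b) ∂ν ∂μ = ∫⁻ a, ∫⁻ b, G (a, b) ∂ν ∂μ := by
  rw [← lintegral_prod _ hF.aemeasurable, ← lintegral_prod _ hG.aemeasurable,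
    lintegral_prod_symm _ hF.aemeasurable, lintegral_prod_symm _ hG.aemeasurable]
  exact lintegral_congr h

/-- For the Gaussian input, given the side information, the first output has the law
`estimatorKernel`. -/
theorem lintegral_gaussian_output [IsProbabilityMeasure π] (hS₁ : S₁.PosDef)
    (hS₂ : S₂.PosDef) (hρ : 0 ≤ ρ)
    {f : SideInfo M N₁ N₂ × (Fin N₁ → ℂ) → ℝ≥0∞} (hf : Measurable f) :
    ∫⁻ x, ∫⁻ h, f (sideOutput x h, mainOutput x h) ∂(fadingNoiseLaw π S₁ S₂)
        ∂(complexGaussian ((ρ : ℂ) • (1 : Matrix (Fin M) (Fin M) ℂ))) =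
      ∫⁻ x, ∫⁻ h, ∫⁻ y, f (sideOutput x h, y) ∂(estimatorKernel M hS₁ hS₂ hρ (sideOutput x h))
        ∂(fadingNoiseLaw π S₁ S₂)
        ∂(complexGaussian ((ρ : ℂ) • (1 : Matrix (Fin M) (Fin M) ℂ))) := by
  have hK : Measurable fun s : SideInfo M N₁ N₂ =>
      ∫⁻ y, f (s, y) ∂(estimatorKernel M hS₁ hS₂ hρ s) := hf.lintegral_kernel_prod_right'
  have m1 : Measurable fun q : (Fin M → ℂ) × (Matrix (Fin N₁) (Fin M) ℂ ×
      Matrix (Fin N₂) (Fin M) ℂ) =>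
      ∫⁻ n, f (sideOutput q.1 (q.2, n), mainOutput q.1 (q.2, n))
        ∂((complexGaussian S₁).prod (complexGaussian S₂)) := by
    refine Measurable.lintegral_prod_right' (f := fun p : ((Fin M → ℂ) × (Matrix (Fin N₁) (Fin M) ℂ ×
      Matrix (Fin N₂) (Fin M) ℂ)) × ((Fin N₁ → ℂ) × (Fin N₂ → ℂ)) =>
      f (sideOutput p.1.1 (p.1.2, p.2), mainOutput p.1.1 (p.1.2, p.2))) ?_
    fun_prop
  have m2 : Measurable fun q : (Fin M → ℂ) × (Matrix (Fin N₁) (Fin M) ℂ ×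
      Matrix (Fin N₂) (Fin M) ℂ) =>
      ∫⁻ n, ∫⁻ y, f (sideOutput q.1 (q.2, n), y)
        ∂(estimatorKernel M hS₁ hS₂ hρ (sideOutput q.1 (q.2, n)))
        ∂((complexGaussian S₁).prod (complexGaussian S₂)) := by
    refine Measurable.lintegral_prod_right' (f := fun p : ((Fin M → ℂ) × (Matrix (Fin N₁) (Fin M) ℂ ×
      Matrix (Fin N₂) (Fin M) ℂ)) × ((Fin N₁ → ℂ) × (Fin N₂ → ℂ)) =>
      ∫⁻ y, f (sideOutput p.1.1 (p.1.2, p.2), y)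
        ∂(estimatorKernel M hS₁ hS₂ hρ (sideOutput p.1.1 (p.1.2, p.2)))) ?_
    exact hK.comp (by fun_prop)
  have s1 : ∀ x : Fin M → ℂ, ∫⁻ h, f (sideOutput x h, mainOutput x h) ∂(fadingNoiseLaw π S₁ S₂) =
      ∫⁻ h, ∫⁻ n, f (sideOutput x (h, n), mainOutput x (h, n))
        ∂((complexGaussian S₁).prod (complexGaussian S₂)) ∂π := fun x => by
    rw [fadingNoiseLaw, lintegral_prod _ (by fun_prop)]
  have s2 : ∀ x : Fin M → ℂ,
      ∫⁻ h, ∫⁻ y, f (sideOutput x h, y) ∂(estimatorKernel M hS₁ hS₂ hρ (sideOutput x h))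
        ∂(fadingNoiseLaw π S₁ S₂) =
      ∫⁻ h, ∫⁻ n, ∫⁻ y, f (sideOutput x (h, n), y)
        ∂(estimatorKernel M hS₁ hS₂ hρ (sideOutput x (h, n)))
        ∂((complexGaussian S₁).prod (complexGaussian S₂)) ∂π := fun x => by
    have mm : Measurable fun h : (Matrix (Fin N₁) (Fin M) ℂ × Matrix (Fin N₂) (Fin M) ℂ) ×
        ((Fin N₁ → ℂ) × (Fin N₂ → ℂ)) =>
        ∫⁻ y, f (sideOutput x h, y) ∂(estimatorKernel M hS₁ hS₂ hρ (sideOutput x h)) :=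
      hK.comp (by fun_prop)
    rw [fadingNoiseLaw, lintegral_prod _ mm.aemeasurable]
  refine (lintegral_congr s1).trans (Eq.trans ?_ (lintegral_congr s2).symm)
  exact lintegral_lintegral_congr_swap m1 m2 fun h =>
    lintegral_gaussian_observation hS₁ hS₂ hρ hf h.1 h.2

/-- The mean divergence of the conditional law of the first output from the estimator kernel. -/
noncomputable def meanDivergence (hS₁ : S₁.PosDef) (hS₂ : S₂.PosDef) (hρ : 0 ≤ ρ)
    (x : Fin M → ℂ) : ℝ≥0∞ :=
  ∫⁻ h, klDiv (outputKernel M N₂ hS₁ (sideOutput x h, x))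
    (estimatorKernel M hS₁ hS₂ hρ (sideOutput x h)) ∂(fadingNoiseLaw π S₁ S₂)

theorem meanDivergence_eq (hS₁ : S₁.PosDef) (hS₂ : S₂.PosDef) (hρ : 0 ≤ ρ) (x : Fin M → ℂ) :
    meanDivergence π hS₁ hS₂ hρ x = ∫⁻ h, baseDivergence S₁ S₂ ρ h.1 h.2 ∂π +
      ∫⁻ h, inputDivergence S₁ S₂ ρ h.1 h.2 x ∂π := by
  have mm : Measurable fun h : (Matrix (Fin N₁) (Fin M) ℂ × Matrix (Fin N₂) (Fin M) ℂ) ×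
      ((Fin N₁ → ℂ) × (Fin N₂ → ℂ)) => klDiv (outputKernel M N₂ hS₁ (sideOutput x h, x))
        (estimatorKernel M hS₁ hS₂ hρ (sideOutput x h)) :=
    (measurable_klDiv_outputKernel (M := M) hS₁ hS₂ hρ).comp
      (by fun_prop : Measurable fun h => (sideOutput x h, x))
  rw [meanDivergence, fadingNoiseLaw, lintegral_prod _ mm.aemeasurable,
    ← lintegral_add_left (by fun_prop)]
  refine lintegral_congr fun h => ?_
  have mh : Measurable fun n : (Fin N₁ → ℂ) × (Fin N₂ → ℂ) =>
      klDiv (outputKernel M N₂ hS₁ (sideOutput x (h, n), x))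
        (estimatorKernel M hS₁ hS₂ hρ (sideOutput x (h, n))) := mm.comp (by fun_prop)
  rw [← lintegral_klDiv_observation h.1 h.2 hS₁ hS₂ hρ x, lintegral_prod_symm _ mh.aemeasurable]
  simp only [sideOutput, outputKernel_apply, estimatorKernel_apply, lintegral_const, measure_univ,
    mul_one]

end Canonical

/-! ### Unitary invariance makes the averaged quadratic term a multiple of the squared norm. -/

section Isotropy

/-- The normalised `x` extends to an orthonormal basis with `x / ‖x‖` at index `i`; its vectors are
the columns of `Q`. -/
theorem exists_unitary_mulVec_single {M : ℕ} (i : Fin M) (x : Fin M → ℂ) :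
    ∃ Q ∈ Matrix.unitaryGroup (Fin M) ℂ,
      Q *ᵥ ((‖WithLp.toLp 2 x‖ : ℂ) • Pi.single i 1) = x := by
  rcases eq_or_ne x 0 with rfl | hx
  · exact ⟨1, one_mem _, by simp⟩
  set r : ℝ := ‖WithLp.toLp 2 x‖ with hr
  have hr0 : r ≠ 0 := by
    rw [hr, norm_ne_zero_iff]
    exact fun h => hx (congrArg WithLp.ofLp h)
  let w : EuclideanSpace ℂ (Fin M) := ((r⁻¹ : ℝ) : ℂ) • WithLp.toLp 2 x
  have hw : ‖w‖ = 1 := by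
    rw [norm_smul, Complex.norm_real, norm_inv, Real.norm_of_nonneg (norm_nonneg _)]
    exact inv_mul_cancel₀ hr0
  have ho : Orthonormal ℂ (({i} : Set (Fin M)).domRestrict fun _ => w) :=
    ⟨fun _ => hw, fun a b hab => (hab (Subsingleton.elim a b)).elim⟩
  obtain ⟨b, hb⟩ := ho.exists_orthonormalBasis_extension_of_card_eq (by simp)
  refine ⟨(EuclideanSpace.basisFun (Fin M) ℂ).toBasis.toMatrix b,
    (EuclideanSpace.basisFun (Fin M) ℂ).toMatrix_orthonormalBasis_mem_unitary b, ?_⟩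
  ext k
  rw [Matrix.mulVec_smul, Matrix.mulVec_single_one]
  have h := hb i rfl
  simp only [Pi.smul_apply, Matrix.col_apply, Module.Basis.toMatrix_apply, h, w]
  simp [hr0]

theorem enorm_sq_toLp {M : ℕ} (x : Fin M → ℂ) :
    ‖(‖WithLp.toLp 2 x‖ : ℂ)‖ₑ ^ 2 = ∑ k, ‖x k‖ₑ ^ 2 := by
  rw [← ofReal_norm, Complex.norm_real, norm_norm, ← ENNReal.ofReal_pow (norm_nonneg _),
    EuclideanSpace.norm_sq_eq, ofReal_sum_norm_sq]

/-- A functional of a vector which is quadratic in scalars and invariant under unitary maps is a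
multiple of the squared norm. -/
theorem exists_eq_mul_sum_enorm_sq {M : ℕ} {Φ : (Fin M → ℂ) → ℝ≥0∞}
    (hsmul : ∀ (c : ℂ) x, Φ (c • x) = ‖c‖ₑ ^ 2 * Φ x)
    (hunit : ∀ Q ∈ Matrix.unitaryGroup (Fin M) ℂ, ∀ x, Φ (Q *ᵥ x) = Φ x) :
    ∃ φ : ℝ≥0∞, (M = 0 → φ = 0) ∧ ∀ x, Φ x = φ * ∑ k, ‖x k‖ₑ ^ 2 := by
  rcases M with _ | M
  -- In dimension zero every vector is `0` and `Φ` vanishes. The choice `φ = 0` is needed because `P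
  -- / M` is then `0` and the Gaussian input does not have power `P`.
  · refine ⟨0, fun _ => rfl, fun x => ?_⟩
    have h := hsmul 0 x
    rw [Subsingleton.elim (0 • x) x] at h
    simpa using h
  · refine ⟨Φ (Pi.single 0 1), fun h => absurd h (Nat.succ_ne_zero M), fun x => ?_⟩
    obtain ⟨Q, hQ, hQx⟩ := exists_unitary_mulVec_single 0 x
    have h := hunit Q hQ ((‖WithLp.toLp 2 x‖ : ℂ) • Pi.single 0 1)
    rw [hQx, hsmul, enorm_sq_toLp] at h
    rw [h, mul_comm]

variable {M N₁ N₂ : ℕ} {S₁ : Matrix (Fin N₁) (Fin N₁) ℂ} {S₂ : Matrix (Fin N₂) (Fin N₂) ℂ} {ρ : ℝ}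

theorem inputDivergence_smul (A : Matrix (Fin N₁) (Fin M) ℂ) (B : Matrix (Fin N₂) (Fin M) ℂ)
    (c : ℂ) (x : Fin M → ℂ) :
    inputDivergence S₁ S₂ ρ A B (c • x) = ‖c‖ₑ ^ 2 * inputDivergence S₁ S₂ ρ A B x := by
  have h : ∀ (C : Matrix (Fin N₁) (Fin N₁) ℂ) u,
      invQuadForm C (c • u) = ‖c‖ ^ 2 * invQuadForm C u := by
    intro C u
    have hc : star c * c = ((‖c‖ ^ 2 : ℝ) : ℂ) := by
      rw [Complex.ofReal_pow]; exact Complex.conj_mul' c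
    rw [invQuadForm, invQuadForm, Matrix.mulVec_smul, star_smul, smul_dotProduct, dotProduct_smul,
      smul_smul, hc, smul_eq_mul, Complex.re_ofReal_mul]
  rw [inputDivergence, inputDivergence, Matrix.mulVec_smul, h, ENNReal.ofReal_mul (by positivity),
    ENNReal.ofReal_pow (norm_nonneg _), ofReal_norm]

/-- `Q` leaves the estimator and the error covariance unchanged, so it only acts through `A - T B`
and can be absorbed into the input. -/
theorem inputDivergence_mul_unitary (A : Matrix (Fin N₁) (Fin M) ℂ) (B : Matrix (Fin N₂) (Fin M) ℂ)
    (hS₂ : S₂.PosDef) (hρ : 0 ≤ ρ) {Q : Matrix (Fin M) (Fin M) ℂ}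
    (hQ : Q ∈ Matrix.unitaryGroup (Fin M) ℂ) (x : Fin M → ℂ) :
    inputDivergence S₁ S₂ ρ (A * Q) (B * Q) x = inputDivergence S₁ S₂ ρ A B (Q *ᵥ x) := by
  rw [inputDivergence, inputDivergence, errorCov_mul_unitary A B hS₂ hρ hQ,
    lmmse_mul_unitary A B hQ, Matrix.mulVec_mulVec, Matrix.sub_mul, Matrix.mul_assoc]

variable {Ω : Type*} [MeasurableSpace Ω] {μ : Measure Ω} {A : Ω → Matrix (Fin N₁) (Fin M) ℂ}
  {B : Ω → Matrix (Fin N₂) (Fin M) ℂ}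

theorem IsIsotropic.map_mul (hAB : IsIsotropic μ (fun ω => Matrix.fromRows (A ω) (B ω)))
    {Q : Matrix (Fin M) (Fin M) ℂ} (hQ : Q ∈ Matrix.unitaryGroup (Fin M) ℂ) :
    μ.map (fun ω => (A ω * Q, B ω * Q)) = μ.map fun ω => (A ω, B ω) := by
  have m : Measurable fun G : Matrix (Fin N₁ ⊕ Fin N₂) (Fin M) ℂ => (G.toRows₁, G.toRows₂) :=
    Continuous.measurable (by
      refine Continuous.prodMk ?_ ?_ <;>
        exact continuous_pi fun i => continuous_pi fun j => by
          simp only [Matrix.toRows₁_apply, Matrix.toRows₂_apply]; fun_prop)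
  have h := ((hAB Q hQ).comp m).map_eq
  simpa only [Function.comp_def, Matrix.fromRows_mul, Matrix.toRows₁_fromRows,
    Matrix.toRows₂_fromRows] using h

/-- Isotropy inserts `Q` into the fading without changing its law; `inputDivergence_mul_unitary`
then moves it onto `x`. -/
theorem IsIsotropic.exists_lintegral_inputDivergence (hS₂ : S₂.PosDef) (hρ : 0 ≤ ρ)
    (hA : Measurable A) (hB : Measurable B)
    (hAB : IsIsotropic μ (fun ω => Matrix.fromRows (A ω) (B ω))) :
    ∃ φ : ℝ≥0∞, (M = 0 → φ = 0) ∧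
      ∀ x, ∫⁻ h, inputDivergence S₁ S₂ ρ h.1 h.2 x ∂(μ.map fun ω => (A ω, B ω)) =
        φ * ∑ k, ‖x k‖ₑ ^ 2 := by
  refine exists_eq_mul_sum_enorm_sq (fun c x => ?_) fun Q hQ x => ?_
  · simp_rw [inputDivergence_smul]
    exact lintegral_const_mul' _ _ (by finiteness)
  · conv_rhs => rw [← hAB.map_mul hQ]
    rw [lintegral_map (by fun_prop) (by fun_prop), lintegral_map (by fun_prop) (by fun_prop)]
    simp_rw [inputDivergence_mul_unitary _ _ hS₂ hρ hQ]

end Isotropy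

/-! ### The mean divergence as an affine function of the input power. -/

section MeanDivergence

variable {M N₁ N₂ : ℕ} {S₁ : Matrix (Fin N₁) (Fin N₁) ℂ} {S₂ : Matrix (Fin N₂) (Fin N₂) ℂ}

theorem lintegral_sum_enorm_sq_complexGaussian {N : ℕ} {ρ : ℝ} (hρ : 0 ≤ ρ) :
    ∫⁻ x, ∑ k, ‖x k‖ₑ ^ 2 ∂(complexGaussian ((ρ : ℂ) • (1 : Matrix (Fin N) (Fin N) ℂ))) =
      ENNReal.ofReal (N * ρ) := by
  have h := lintegral_sum_enorm_mulVec_add_sq (posSemidef_ofReal_smul hρ Matrix.PosSemidef.one)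
    (1 : Matrix (Fin N) (Fin N) ℂ) 0
  simpa [Matrix.trace_smul, mul_comm] using h

theorem measurable_meanDivergence
    (π : Measure (Matrix (Fin N₁) (Fin M) ℂ × Matrix (Fin N₂) (Fin M) ℂ))
    [IsProbabilityMeasure π] (hS₁ : S₁.PosDef) (hS₂ : S₂.PosDef) {ρ : ℝ} (hρ : 0 ≤ ρ) :
    Measurable (meanDivergence π hS₁ hS₂ hρ) := by
  have m : Measurable fun p : (Fin M → ℂ) × (Matrix (Fin N₁) (Fin M) ℂ × Matrix (Fin N₂) (Fin M) ℂ) =>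
      inputDivergence S₁ S₂ ρ p.2.1 p.2.2 p.1 := by fun_prop
  have h : Measurable fun x => ∫⁻ h, baseDivergence S₁ S₂ ρ h.1 h.2 ∂π +
      ∫⁻ h, inputDivergence S₁ S₂ ρ h.1 h.2 x ∂π :=
    measurable_const.add m.lintegral_prod_right'
  rwa [← funext fun x => meanDivergence_eq π hS₁ hS₂ hρ x] at h

theorem lintegral_meanDivergence
    (π : Measure (Matrix (Fin N₁) (Fin M) ℂ × Matrix (Fin N₂) (Fin M) ℂ))
    [IsProbabilityMeasure π] (hS₁ : S₁.PosDef) (hS₂ : S₂.PosDef) {ρ : ℝ} (hρ : 0 ≤ ρ) :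
    ∫⁻ x, meanDivergence π hS₁ hS₂ hρ x
        ∂(complexGaussian ((ρ : ℂ) • (1 : Matrix (Fin M) (Fin M) ℂ))) =
      ∫⁻ h, ENNReal.ofReal (Real.log (errorCov S₁ S₂ ρ h.1 h.2).det.re - Real.log S₁.det.re) ∂π := by
  have m : Measurable fun p : (Fin M → ℂ) × (Matrix (Fin N₁) (Fin M) ℂ × Matrix (Fin N₂) (Fin M) ℂ) =>
      inputDivergence S₁ S₂ ρ p.2.1 p.2.2 p.1 := by fun_prop
  have swap := (lintegral_prod (μ := complexGaussian ((ρ : ℂ) • (1 : Matrix (Fin M) (Fin M) ℂ)))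
    (ν := π) _ m.aemeasurable).symm.trans (lintegral_prod_symm _ m.aemeasurable)
  refine (lintegral_congr fun x => meanDivergence_eq π hS₁ hS₂ hρ x).trans ?_
  rw [lintegral_add_left measurable_const, lintegral_const, measure_univ, mul_one, swap,
    ← lintegral_add_left (by fun_prop)]
  exact lintegral_congr fun h =>
    baseDivergence_add_lintegral_inputDivergence h.1 h.2 hS₁ hS₂ hρ

variable {Ω : Type*} [MeasurableSpace Ω] {μ : Measure Ω} [IsProbabilityMeasure μ]
  {A : Ω → Matrix (Fin N₁) (Fin M) ℂ} {B : Ω → Matrix (Fin N₂) (Fin M) ℂ}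

/-- Under isotropic fading the mean divergence depends on the input only through its norm, and
its mean for the Gaussian input is the one for every input of the same power. -/
theorem IsIsotropic.exists_meanDivergence_eq (hS₁ : S₁.PosDef) (hS₂ : S₂.PosDef) {P : ℝ}
    (hρ : 0 ≤ P / M) (hA : Measurable A) (hB : Measurable B)
    (hAB : IsIsotropic μ (fun ω => Matrix.fromRows (A ω) (B ω))) :
    ∃ c φ : ℝ≥0∞,
      (∀ x, meanDivergence (μ.map fun ω => (A ω, B ω)) hS₁ hS₂ hρ x = c + φ * ∑ k, ‖x k‖ₑ ^ 2) ∧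
      ∫⁻ x, meanDivergence (μ.map fun ω => (A ω, B ω)) hS₁ hS₂ hρ x
        ∂(complexGaussian (((P / M : ℝ) : ℂ) • (1 : Matrix (Fin M) (Fin M) ℂ))) =
        c + φ * ENNReal.ofReal P := by
  obtain ⟨φ, hφ0, hφ⟩ := hAB.exists_lintegral_inputDivergence (S₁ := S₁) hS₂ hρ hA hB
  have := Measure.isProbabilityMeasure_map (μ := μ) (hA.prodMk hB).aemeasurable
  refine ⟨_, φ, fun x => (meanDivergence_eq _ hS₁ hS₂ hρ x).trans (by rw [hφ]), ?_⟩
  simp_rw [meanDivergence_eq, hφ]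
  rw [lintegral_add_left measurable_const, lintegral_const, measure_univ, mul_one,
    lintegral_const_mul _ (by fun_prop), lintegral_sum_enorm_sq_complexGaussian hρ]
  rcases eq_or_ne M 0 with h0 | h0
  -- For `M = 0` the Gaussian power is `0` instead of `P`; the vanishing of `φ` hides the
  -- difference.
  · rw [hφ0 h0, zero_mul, zero_mul]
  · rw [mul_div_cancel₀ _ (Nat.cast_ne_zero.mpr h0)]

end MeanDivergence

/-! ### The bound and the equality for one channel use. -/

section SingleUse

theorem map_comp_prodMk {Ω α β δ : Type*} [MeasurableSpace Ω] [MeasurableSpace α]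
    [MeasurableSpace β] [MeasurableSpace δ] {μ : Measure Ω} {X : Ω → α} {W : Ω → β}
    {η : Measure (α × β)} (hX : AEMeasurable X μ) (hW : AEMeasurable W μ)
    (hlaw : μ.map (fun ω => (X ω, W ω)) = η) {F : α × β → δ} (hF : Measurable F) :
    μ.map (fun ω => F (X ω, W ω)) = η.map F := by
  rw [← hlaw, AEMeasurable.map_map_of_aemeasurable hF.aemeasurable (hX.prodMk hW)]
  rfl

variable {M N₁ N₂ : ℕ} {S₁ : Matrix (Fin N₁) (Fin N₁) ℂ} {S₂ : Matrix (Fin N₂) (Fin N₂) ℂ} {ρ : ℝ}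

/-- The fading matrices together with the noise vectors. -/
abbrev FadingNoise (M N₁ N₂ : ℕ) : Type :=
  (Matrix (Fin N₁) (Fin M) ℂ × Matrix (Fin N₂) (Fin M) ℂ) × ((Fin N₁ → ℂ) × (Fin N₂ → ℂ))

variable (ξ : Measure (Fin M → ℂ))
  (π : Measure (Matrix (Fin N₁) (Fin M) ℂ × Matrix (Fin N₂) (Fin M) ℂ)) [IsProbabilityMeasure π]

theorem map_output_eq_compProd [SFinite ξ] (hS₁ : S₁.PosDef) :
    (ξ.prod (fadingNoiseLaw π S₁ S₂)).map
        (fun p => ((sideOutput p.1 p.2, p.1), mainOutput p.1 p.2)) =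
      (ξ.prod (fadingNoiseLaw π S₁ S₂)).map (fun p => (sideOutput p.1 p.2, p.1)) ⊗ₘ
        outputKernel M N₂ hS₁ := by
  have m : Measurable fun p : (Fin M → ℂ) × FadingNoise M N₁ N₂ =>
    (sideOutput p.1 p.2, p.1) := by fun_prop
  refine Measure.ext_of_lintegral _ fun f hf => ?_
  have mκ := hf.lintegral_kernel_prod_right' (κ := outputKernel M N₂ hS₁)
  have mκ' := mκ.comp m
  have ml : Measurable fun p : (Fin M → ℂ) × FadingNoise M N₁ N₂ =>
    f ((sideOutput p.1 p.2, p.1), mainOutput p.1 p.2) := by fun_prop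
  rw [Measure.lintegral_compProd hf, lintegral_map hf (by fun_prop), lintegral_map mκ m,
    lintegral_prod _ ml.aemeasurable]
  refine Eq.trans ?_ (lintegral_prod _ mκ'.aemeasurable).symm
  exact lintegral_congr fun x => lintegral_fadingNoiseLaw_output π hS₁ x
    (f := fun q => f ((q.1, x), q.2)) (by fun_prop)

theorem map_gaussian_output_eq_compProd (hS₁ : S₁.PosDef) (hS₂ : S₂.PosDef) (hρ : 0 ≤ ρ) :
    ((complexGaussian ((ρ : ℂ) • (1 : Matrix (Fin M) (Fin M) ℂ))).prod
        (fadingNoiseLaw π S₁ S₂)).map (fun p => (sideOutput p.1 p.2, mainOutput p.1 p.2)) =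
      ((complexGaussian ((ρ : ℂ) • (1 : Matrix (Fin M) (Fin M) ℂ))).prod
        (fadingNoiseLaw π S₁ S₂)).map (fun p => sideOutput p.1 p.2) ⊗ₘ
        estimatorKernel M hS₁ hS₂ hρ := by
  have m : Measurable fun p : (Fin M → ℂ) × FadingNoise M N₁ N₂ => sideOutput p.1 p.2 := by
    fun_prop
  refine Measure.ext_of_lintegral _ fun f hf => ?_
  have mκ := hf.lintegral_kernel_prod_right' (κ := estimatorKernel M hS₁ hS₂ hρ)
  have mκ' := mκ.comp m
  have ml : Measurable fun p : (Fin M → ℂ) × FadingNoise M N₁ N₂ =>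
    f (sideOutput p.1 p.2, mainOutput p.1 p.2) := by fun_prop
  rw [Measure.lintegral_compProd hf, lintegral_map hf (by fun_prop), lintegral_map mκ m,
    lintegral_prod _ ml.aemeasurable]
  refine Eq.trans ?_ (lintegral_prod _ mκ'.aemeasurable).symm
  exact lintegral_gaussian_output π hS₁ hS₂ hρ hf

theorem lintegral_klDiv_output (hS₁ : S₁.PosDef) (hS₂ : S₂.PosDef) (hρ : 0 ≤ ρ) :
    ∫⁻ p, InformationTheory.klDiv (outputKernel M N₂ hS₁ p) (estimatorKernel M hS₁ hS₂ hρ p.1)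
        ∂((ξ.prod (fadingNoiseLaw π S₁ S₂)).map fun p => (sideOutput p.1 p.2, p.1)) =
      ∫⁻ x, meanDivergence π hS₁ hS₂ hρ x ∂ξ := by
  have m : Measurable fun p : (Fin M → ℂ) × FadingNoise M N₁ N₂ =>
    (sideOutput p.1 p.2, p.1) := by fun_prop
  have mk := measurable_klDiv_outputKernel (M := M) hS₁ hS₂ hρ
  rw [lintegral_map mk m]
  exact lintegral_prod _ (mk.comp m).aemeasurable

variable {Ω : Type*} [MeasurableSpace Ω] {μ : Measure Ω} [IsProbabilityMeasure μ]
  {X : Ω → Fin M → ℂ} {W : Ω → FadingNoise M N₁ N₂}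

theorem condMutualInfo_channel_le [SFinite ξ] (hS₁ : S₁.PosDef) (hS₂ : S₂.PosDef)
    (hρ : 0 ≤ ρ)
    (hX : AEMeasurable X μ) (hW : AEMeasurable W μ)
    (hlaw : μ.map (fun ω => (X ω, W ω)) = ξ.prod (fadingNoiseLaw π S₁ S₂)) :
    condMutualInfo μ (fun ω => mainOutput (X ω) (W ω)) X (fun ω => sideOutput (X ω) (W ω)) ≤
      (∫⁻ x, meanDivergence π hS₁ hS₂ hρ x ∂ξ) / ENNReal.ofReal (Real.log 2) := by
  have hm : Measurable fun p : (Fin M → ℂ) × FadingNoise M N₁ N₂ => mainOutput p.1 p.2 := by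
    fun_prop
  have hs : Measurable fun p : (Fin M → ℂ) × FadingNoise M N₁ N₂ => sideOutput p.1 p.2 := by
    fun_prop
  have hVX := map_comp_prodMk hX hW hlaw (hs.prodMk measurable_fst)
  rw [← lintegral_klDiv_output ξ π hS₁ hS₂ hρ, ← hVX]
  refine condMutualInfo_le_lintegral (hm.comp_aemeasurable (hX.prodMk hW)) hX
    (hs.comp_aemeasurable (hX.prodMk hW)) (estimatorKernel M hS₁ hS₂ hρ) (outputKernel M N₂ hS₁)
    ?_ (outputKernel_absolutelyContinuous hS₁ hS₂ hρ)
  exact (map_comp_prodMk hX hW hlaw ((hs.prodMk measurable_fst).prodMk hm)).trans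
    ((map_output_eq_compProd ξ π hS₁).trans (congrArg (· ⊗ₘ outputKernel M N₂ hS₁) hVX.symm))

theorem condMutualInfo_gaussian_channel (hS₁ : S₁.PosDef) (hS₂ : S₂.PosDef) (hρ : 0 ≤ ρ)
    (hX : AEMeasurable X μ) (hW : AEMeasurable W μ)
    (hlaw : μ.map (fun ω => (X ω, W ω)) =
      (complexGaussian ((ρ : ℂ) • (1 : Matrix (Fin M) (Fin M) ℂ))).prod
        (fadingNoiseLaw π S₁ S₂)) :
    condMutualInfo μ (fun ω => mainOutput (X ω) (W ω)) X (fun ω => sideOutput (X ω) (W ω)) =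
      (∫⁻ x, meanDivergence π hS₁ hS₂ hρ x
        ∂(complexGaussian ((ρ : ℂ) • (1 : Matrix (Fin M) (Fin M) ℂ)))) /
        ENNReal.ofReal (Real.log 2) := by
  set ξ := complexGaussian ((ρ : ℂ) • (1 : Matrix (Fin M) (Fin M) ℂ))
  have hm : Measurable fun p : (Fin M → ℂ) × FadingNoise M N₁ N₂ => mainOutput p.1 p.2 := by
    fun_prop
  have hs : Measurable fun p : (Fin M → ℂ) × FadingNoise M N₁ N₂ => sideOutput p.1 p.2 := by
    fun_prop
  have hVX := map_comp_prodMk hX hW hlaw (hs.prodMk measurable_fst)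
  rw [← lintegral_klDiv_output ξ π hS₁ hS₂ hρ, ← hVX]
  refine condMutualInfo_eq_lintegral (hm.comp_aemeasurable (hX.prodMk hW)) hX
    (hs.comp_aemeasurable (hX.prodMk hW)) (estimatorKernel M hS₁ hS₂ hρ) (outputKernel M N₂ hS₁)
    ?_ (outputKernel_absolutelyContinuous hS₁ hS₂ hρ) ?_
  · exact (map_comp_prodMk hX hW hlaw ((hs.prodMk measurable_fst).prodMk hm)).trans
      ((map_output_eq_compProd ξ π hS₁).trans (congrArg (· ⊗ₘ outputKernel M N₂ hS₁) hVX.symm))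
  · exact (map_comp_prodMk hX hW hlaw (hs.prodMk hm)).trans
      ((map_gaussian_output_eq_compProd π hS₁ hS₂ hρ).trans
        (congrArg (· ⊗ₘ estimatorKernel M hS₁ hS₂ hρ) (map_comp_prodMk hX hW hlaw hs).symm))

end SingleUse

/-! ### The maximum as a difference of expected log-determinants, and integrability. -/

section Value

variable {Ω : Type*} [MeasurableSpace Ω] {μ : Measure Ω}

theorem lintegral_ofReal_sub_eq_ofReal {f g : Ω → ℝ} (hf : Integrable f μ) (hg : Integrable g μ)
    (h : ∀ ω, g ω ≤ f ω) :
    ∫⁻ ω, ENNReal.ofReal (f ω - g ω) ∂μ = ENNReal.ofReal ((∫ ω, f ω ∂μ) - ∫ ω, g ω ∂μ) := by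
  rw [← integral_sub hf hg]
  exact (ofReal_integral_eq_lintegral_ofReal (hf.sub hg)
    (.of_forall fun ω => sub_nonneg.mpr (h ω))).symm

/-- A finite integral would make `f - g` integrable, and with `g` also `f`. -/
theorem lintegral_ofReal_sub_eq_top {f g : Ω → ℝ} (hfm : Measurable f) (hg : Integrable g μ)
    (h : ∀ ω, g ω ≤ f ω) (hf : ¬ Integrable f μ) : ∫⁻ ω, ENNReal.ofReal (f ω - g ω) ∂μ = ∞ := by
  by_contra hne
  have hi := (lintegral_ofReal_ne_top_iff_integrable
    (hfm.aestronglyMeasurable.sub hg.aestronglyMeasurable)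
    (.of_forall fun ω => sub_nonneg.mpr (h ω))).mp hne
  exact hf (by simpa using hi.add hg)

variable {M N₁ N₂ : ℕ} {S₁ : Matrix (Fin N₁) (Fin N₁) ℂ} {S₂ : Matrix (Fin N₂) (Fin N₂) ℂ} {ρ : ℝ}

theorem logDetJoint_sub_logDetSide (hS₁ : S₁.PosDef) (hS₂ : S₂.PosDef) (hρ : 0 ≤ ρ)
    (A : Matrix (Fin N₁) (Fin M) ℂ) (B : Matrix (Fin N₂) (Fin M) ℂ) :
    logDetJoint S₁ S₂ ρ A B - logDetSide S₁ S₂ ρ B =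
      (Real.log (errorCov S₁ S₂ ρ A B).det.re - Real.log S₁.det.re) / Real.log 2 := by
  rw [logDetJoint_eq A B hS₁ hS₂ hρ, logDetSide_eq B hS₁ hS₂ hρ, ← sub_div,
    add_sub_add_left_eq_sub]

theorem logDetSide_le_logDetJoint (hS₁ : S₁.PosDef) (hS₂ : S₂.PosDef) (hρ : 0 ≤ ρ)
    (A : Matrix (Fin N₁) (Fin M) ℂ) (B : Matrix (Fin N₂) (Fin M) ℂ) :
    logDetSide S₁ S₂ ρ B ≤ logDetJoint S₁ S₂ ρ A B := by
  rw [← sub_nonneg, logDetJoint_sub_logDetSide hS₁ hS₂ hρ]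
  exact div_nonneg (log_det_errorCov_sub_nonneg A B hS₁ hS₂ hρ) (Real.log_nonneg one_le_two)

variable {A : Ω → Matrix (Fin N₁) (Fin M) ℂ} {B : Ω → Matrix (Fin N₂) (Fin M) ℂ}

theorem lintegral_log_det_errorCov_div (hS₁ : S₁.PosDef) (hS₂ : S₂.PosDef) (hρ : 0 ≤ ρ) :
    (∫⁻ ω, ENNReal.ofReal (Real.log (errorCov S₁ S₂ ρ (A ω) (B ω)).det.re -
        Real.log S₁.det.re) ∂μ) / ENNReal.ofReal (Real.log 2) =
      ∫⁻ ω, ENNReal.ofReal (logDetJoint S₁ S₂ ρ (A ω) (B ω) - logDetSide S₁ S₂ ρ (B ω)) ∂μ := by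
  simp_rw [logDetJoint_sub_logDetSide hS₁ hS₂ hρ,
    ENNReal.ofReal_div_of_pos (Real.log_pos one_lt_two), div_eq_mul_inv]
  rw [lintegral_mul_const' _ _ (by simp [Real.log_pos one_lt_two])]

theorem measurable_logDetJoint (hS₁ : S₁.PosDef) (hS₂ : S₂.PosDef) (hρ : 0 ≤ ρ)
    (hA : Measurable A) (hB : Measurable B) :
    Measurable fun ω => logDetJoint S₁ S₂ ρ (A ω) (B ω) := by
  simp_rw [logDetJoint_eq _ _ hS₁ hS₂ hρ]
  fun_prop

theorem trace_add_smul_re {N : ℕ} (S : Matrix (Fin N) (Fin N) ℂ) (F : Matrix (Fin N) (Fin M) ℂ) :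
    (S + (ρ : ℂ) • (F * Fᴴ)).trace.re = S.trace.re + ρ * ∑ i, ∑ j, ‖F i j‖ ^ 2 := by
  rw [Matrix.trace_add, Matrix.trace_smul, Complex.add_re, smul_eq_mul, Complex.re_ofReal_mul,
    trace_mul_conjTranspose_re]

/-- The term subtracted in `errorCov_eq` is positive semidefinite: observing cannot increase the
error. The bound is therefore free of `B`. -/
theorem trace_errorCov_re_le (hS₂ : S₂.PosDef) (hρ : 0 ≤ ρ)
    (A : Matrix (Fin N₁) (Fin M) ℂ) (B : Matrix (Fin N₂) (Fin M) ℂ) :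
    (errorCov S₁ S₂ ρ A B).trace.re ≤ S₁.trace.re + ρ * ∑ i, ∑ j, ‖A i j‖ ^ 2 := by
  have h := ((observationCov_posDef B hS₂ hρ).inv.posSemidef.mul_mul_conjTranspose_same
    ((ρ : ℂ) • (A * Bᴴ))).trace_nonneg
  rw [← lmmse, Matrix.conjTranspose_smul, Matrix.conjTranspose_mul,
    Matrix.conjTranspose_conjTranspose, Complex.star_def, Complex.conj_ofReal] at h
  rw [errorCov_eq A B hS₂ hρ, Matrix.trace_sub, Complex.sub_re, trace_add_smul_re]
  exact sub_le_self _ (Complex.le_def.mp h).1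

variable [IsProbabilityMeasure μ]

theorem integrable_log_det_observationCov (hS₂ : S₂.PosDef) (hρ : 0 ≤ ρ) (hB : Measurable B)
    (hB2 : Integrable (fun ω => ∑ i, ∑ j, ‖B ω i j‖ ^ 2) μ) :
    Integrable (fun ω => Real.log (observationCov S₂ ρ (B ω)).det.re) μ := by
  refine integrable_of_le_of_le (f := fun ω => Real.log (observationCov S₂ ρ (B ω)).det.re)
    (g₁ := fun _ => Real.log S₂.det.re)
    (g₂ := fun ω => S₂.trace.re + ρ * ∑ i, ∑ j, ‖B ω i j‖ ^ 2)
    (Measurable.aestronglyMeasurable (by fun_prop)) (.of_forall fun ω => ?_) (.of_forall fun ω => ?_)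
    (integrable_const _) ((integrable_const _).add (hB2.const_mul ρ))
  · exact sub_nonneg.mp (log_det_add_sub_nonneg hS₂
      (posSemidef_ofReal_smul hρ (Matrix.posSemidef_self_mul_conjTranspose (B ω))))
  · exact (log_det_le_trace (observationCov_posDef (B ω) hS₂ hρ)).trans_eq
      (trace_add_smul_re S₂ (B ω))

theorem integrable_log_det_errorCov (hS₁ : S₁.PosDef) (hS₂ : S₂.PosDef) (hρ : 0 ≤ ρ)
    (hA : Measurable A) (hB : Measurable B)
    (hA2 : Integrable (fun ω => ∑ i, ∑ j, ‖A ω i j‖ ^ 2) μ) :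
    Integrable (fun ω => Real.log (errorCov S₁ S₂ ρ (A ω) (B ω)).det.re) μ := by
  refine integrable_of_le_of_le (f := fun ω => Real.log (errorCov S₁ S₂ ρ (A ω) (B ω)).det.re)
    (g₁ := fun _ => Real.log S₁.det.re)
    (g₂ := fun ω => S₁.trace.re + ρ * ∑ i, ∑ j, ‖A ω i j‖ ^ 2)
    (Measurable.aestronglyMeasurable (by fun_prop)) (.of_forall fun ω => ?_) (.of_forall fun ω => ?_)
    (integrable_const _) ((integrable_const _).add (hA2.const_mul ρ))
  · exact sub_nonneg.mp (log_det_errorCov_sub_nonneg (A ω) (B ω) hS₁ hS₂ hρ)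
  · exact (log_det_le_trace (errorCov_posDef (A ω) (B ω) hS₁ hS₂ hρ)).trans
      (trace_errorCov_re_le hS₂ hρ (A ω) (B ω))

theorem integrable_logDetSide (hS₁ : S₁.PosDef) (hS₂ : S₂.PosDef) (hρ : 0 ≤ ρ) (hB : Measurable B)
    (hB2 : Integrable (fun ω => ∑ i, ∑ j, ‖B ω i j‖ ^ 2) μ) :
    Integrable (fun ω => logDetSide S₁ S₂ ρ (B ω)) μ := by
  simp_rw [logDetSide_eq _ hS₁ hS₂ hρ]
  exact ((integrable_log_det_observationCov hS₂ hρ hB hB2).add (integrable_const _)).div_const _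

theorem integrable_logDetJoint (hS₁ : S₁.PosDef) (hS₂ : S₂.PosDef) (hρ : 0 ≤ ρ)
    (hA : Measurable A) (hB : Measurable B)
    (hA2 : Integrable (fun ω => ∑ i, ∑ j, ‖A ω i j‖ ^ 2) μ)
    (hB2 : Integrable (fun ω => ∑ i, ∑ j, ‖B ω i j‖ ^ 2) μ) :
    Integrable (fun ω => logDetJoint S₁ S₂ ρ (A ω) (B ω)) μ := by
  simp_rw [logDetJoint_eq _ _ hS₁ hS₂ hρ]
  exact ((integrable_log_det_observationCov hS₂ hρ hB hB2).add
    (integrable_log_det_errorCov hS₁ hS₂ hρ hA hB hA2)).div_const _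

end Value

/-! ### The memoryless channel over `n` uses. -/

section BlockUse

open InformationTheory

variable {M N₁ N₂ : ℕ} {S₁ : Matrix (Fin N₁) (Fin N₁) ℂ} {S₂ : Matrix (Fin N₂) (Fin N₂) ℂ} {ρ : ℝ}
  (π : Measure (Matrix (Fin N₁) (Fin M) ℂ × Matrix (Fin N₂) (Fin M) ℂ)) [IsProbabilityMeasure π]
  {n : ℕ}

/-- The joint law of the outputs and the fading for the deterministic input `x`. -/
noncomputable def outputLaw (S₁ : Matrix (Fin N₁) (Fin N₁) ℂ) (S₂ : Matrix (Fin N₂) (Fin N₂) ℂ)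
    (x : Fin M → ℂ) : Measure ((Fin N₁ → ℂ) × SideInfo M N₁ N₂) :=
  (fadingNoiseLaw π S₁ S₂).map fun h => (mainOutput x h, sideOutput x h)

/-- The law of the side information for the deterministic input `x`. -/
noncomputable def sideLaw (S₁ : Matrix (Fin N₁) (Fin N₁) ℂ) (S₂ : Matrix (Fin N₂) (Fin N₂) ℂ)
    (x : Fin M → ℂ) : Measure (SideInfo M N₁ N₂) :=
  (fadingNoiseLaw π S₁ S₂).map fun h => sideOutput x h

instance (x : Fin M → ℂ) : IsProbabilityMeasure (sideLaw π S₁ S₂ x) :=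
  Measure.isProbabilityMeasure_map (by fun_prop)

/-- The conditional law of the first output given the side information, for the deterministic
input `x`. -/
noncomputable def inputOutputKernel (N₂ : ℕ) (hS₁ : S₁.PosDef) (x : Fin M → ℂ) :
    Kernel (SideInfo M N₁ N₂) (Fin N₁ → ℂ) :=
  (outputKernel M N₂ hS₁).comap (fun s => (s, x)) (by fun_prop)

instance (hS₁ : S₁.PosDef) (x : Fin M → ℂ) : IsMarkovKernel (inputOutputKernel N₂ hS₁ x) := by
  unfold inputOutputKernel; infer_instance

theorem outputLaw_eq_map_compProd (hS₁ : S₁.PosDef) (x : Fin M → ℂ) :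
    outputLaw π S₁ S₂ x =
      (sideLaw π S₁ S₂ x ⊗ₘ inputOutputKernel N₂ hS₁ x).map Prod.swap := by
  have m : Measurable fun h : FadingNoise M N₁ N₂ => sideOutput x h := by fun_prop
  refine Measure.ext_of_lintegral _ fun f hf => ?_
  have hf' : Measurable fun q : SideInfo M N₁ N₂ × (Fin N₁ → ℂ) => f q.swap := by fun_prop
  rw [outputLaw, lintegral_map hf (by fun_prop), lintegral_map hf (by fun_prop),
    Measure.lintegral_compProd hf', sideLaw, lintegral_map hf'.lintegral_kernel_prod_right' m]
  exact lintegral_fadingNoiseLaw_output π hS₁ x hf'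

theorem lintegral_pi_outputLaw (hS₁ : S₁.PosDef) (x : Fin n → Fin M → ℂ)
    {G : (Fin n → (Fin N₁ → ℂ) × SideInfo M N₁ N₂) → ℝ≥0∞} (hG : Measurable G) :
    ∫⁻ t, G t ∂(Measure.pi fun i => outputLaw π S₁ S₂ (x i)) =
      ∫⁻ v, ∫⁻ y, G (fun i => (y i, v i)) ∂(Measure.pi fun i => outputKernel M N₂ hS₁ (v i, x i))
        ∂(Measure.pi fun i => sideLaw π S₁ S₂ (x i)) := by
  let K : Kernel (Fin n → SideInfo M N₁ N₂) (Fin n → Fin N₁ → ℂ) :=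
    (piKernel (Fin n) (outputKernel M N₂ hS₁)).comap (fun v i => (v i, x i)) (by fun_prop)
  have hpi := pi_compProd (fun i => sideLaw π S₁ S₂ (x i))
    (fun i => inputOutputKernel N₂ hS₁ (x i)) K fun v => rfl
  have hlaw : (Measure.pi fun i => outputLaw π S₁ S₂ (x i)) =
      (Measure.pi (fun i => sideLaw π S₁ S₂ (x i)) ⊗ₘ K).map fun p i => (p.2 i, p.1 i) := by
    simp_rw [outputLaw_eq_map_compProd π hS₁]
    rw [← Measure.pi_map_pi (fun i => by fun_prop), hpi, Measure.map_map (by fun_prop) (by fun_prop)]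
    rfl
  have hG' : Measurable fun p : (Fin n → SideInfo M N₁ N₂) × (Fin n → Fin N₁ → ℂ) =>
    G fun i => (p.2 i, p.1 i) := by fun_prop
  rw [hlaw, lintegral_map hG (by fun_prop), Measure.lintegral_compProd hG']
  rfl

theorem klDiv_pi_outputKernel (hS₁ : S₁.PosDef) (hS₂ : S₂.PosDef) (hρ : 0 ≤ ρ)
    (v : Fin n → SideInfo M N₁ N₂) (x : Fin n → Fin M → ℂ) :
    klDiv (Measure.pi fun i => outputKernel M N₂ hS₁ (v i, x i))
        (Measure.pi fun i => estimatorKernel M hS₁ hS₂ hρ (v i)) =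
      ∑ i, klDiv (outputKernel M N₂ hS₁ (v i, x i)) (estimatorKernel M hS₁ hS₂ hρ (v i)) :=
  klDiv_pi _ _

/-- For a deterministic input sequence both output laws are products, so the divergence adds over
the uses and each summand sees only its own marginal. -/
theorem lintegral_klDiv_sideLaw (hS₁ : S₁.PosDef) (hS₂ : S₂.PosDef) (hρ : 0 ≤ ρ)
    (x : Fin n → Fin M → ℂ) :
    ∫⁻ v, klDiv (Measure.pi fun i => outputKernel M N₂ hS₁ (v i, x i))
        (Measure.pi fun i => estimatorKernel M hS₁ hS₂ hρ (v i))
        ∂(Measure.pi fun i => sideLaw π S₁ S₂ (x i)) =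
      ∑ i, meanDivergence π hS₁ hS₂ hρ (x i) := by
  have mk := measurable_klDiv_outputKernel (M := M) hS₁ hS₂ hρ
  have mk' : ∀ y : Fin M → ℂ, Measurable fun s : SideInfo M N₁ N₂ =>
      klDiv (outputKernel M N₂ hS₁ (s, y)) (estimatorKernel M hS₁ hS₂ hρ s) := fun y =>
    mk.comp (by fun_prop : Measurable fun s : SideInfo M N₁ N₂ => (s, y))
  simp_rw [klDiv_pi_outputKernel]
  refine (lintegral_finsetSum _ fun i _ => (mk' (x i)).comp (measurable_pi_apply i)).trans
    (Finset.sum_congr rfl fun i _ => ?_)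
  refine ((measurePreserving_eval (fun i => sideLaw π S₁ S₂ (x i)) i).lintegral_comp
    (mk' (x i))).trans ?_
  exact lintegral_map (mk' (x i)) (by fun_prop)

variable {Ω : Type*} [MeasurableSpace Ω] {ν : Measure Ω} [IsProbabilityMeasure ν]
  {X : Ω → Fin n → Fin M → ℂ} {Y : Ω → Fin n → Fin N₁ → ℂ} {Z : Ω → Fin n → Fin N₂ → ℂ}
  {A : Ω → Fin n → Matrix (Fin N₁) (Fin M) ℂ} {B : Ω → Fin n → Matrix (Fin N₂) (Fin M) ℂ}

theorem lintegral_memoryless (hX : Measurable X) (hY : Measurable Y) (hZ : Measurable Z)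
    (hA : Measurable A) (hB : Measurable B) (hS₁ : S₁.PosDef)
    (hcond : ∀ᵐ x ∂(ν.map X),
      condDistrib (fun ω (i : Fin n) => (Y ω i, Z ω i, A ω i, B ω i)) X ν x =
        Measure.pi (fun i => outputLaw π S₁ S₂ (x i)))
    {f : (((Fin n → Fin N₂ → ℂ) × (Fin n → Matrix (Fin N₁) (Fin M) ℂ) ×
      (Fin n → Matrix (Fin N₂) (Fin M) ℂ)) × (Fin n → Fin M → ℂ)) × (Fin n → Fin N₁ → ℂ) → ℝ≥0∞}
    (hf : Measurable f) :
    ∫⁻ ω, f (((Z ω, A ω, B ω), X ω), Y ω) ∂ν =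
      ∫⁻ x, ∫⁻ v, ∫⁻ y,
        f (((fun i => (v i).1, fun i => (v i).2.1, fun i => (v i).2.2), x), y)
          ∂(Measure.pi fun i => outputKernel M N₂ hS₁ (v i, x i))
          ∂(Measure.pi fun i => sideLaw π S₁ S₂ (x i)) ∂(ν.map X) := by
  let T : Ω → Fin n → (Fin N₁ → ℂ) × SideInfo M N₁ N₂ := fun ω i => (Y ω i, Z ω i, A ω i, B ω i)
  have hT : Measurable T := by fun_prop
  let F : (Fin n → Fin M → ℂ) × (Fin n → (Fin N₁ → ℂ) × SideInfo M N₁ N₂) → ℝ≥0∞ := fun p =>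
    f (((fun i => (p.2 i).2.1, fun i => (p.2 i).2.2.1, fun i => (p.2 i).2.2.2), p.1),
      fun i => (p.2 i).1)
  have hF : Measurable F := by fun_prop
  have h1 : ∫⁻ ω, f (((Z ω, A ω, B ω), X ω), Y ω) ∂ν =
      ∫⁻ p, F p ∂(ν.map fun ω => (X ω, T ω)) := (lintegral_map hF (hX.prodMk hT)).symm
  rw [h1, ← compProd_map_condDistrib hT.aemeasurable, Measure.lintegral_compProd hF]
  refine lintegral_congr_ae (hcond.mono fun x hx => ?_)
  have hFx : Measurable fun t => F (x, t) := by fun_prop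
  refine Eq.trans ?_ (lintegral_pi_outputLaw π hS₁ x hFx)
  beta_reduce
  rw [hx]

/-- The conditional mutual information over `n` uses of the memoryless channel is at most the sum
of the mean divergences from the estimator kernel. -/
theorem condMutualInfo_memoryless_le (hX : Measurable X) (hY : Measurable Y) (hZ : Measurable Z)
    (hA : Measurable A) (hB : Measurable B) (hS₁ : S₁.PosDef) (hS₂ : S₂.PosDef) (hρ : 0 ≤ ρ)
    (hcond : ∀ᵐ x ∂(ν.map X),
      condDistrib (fun ω (i : Fin n) => (Y ω i, Z ω i, A ω i, B ω i)) X ν x =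
        Measure.pi (fun i => outputLaw π S₁ S₂ (x i))) :
    condMutualInfo ν Y X (fun ω => (Z ω, A ω, B ω)) ≤
      (∑ i, ∫⁻ ω, meanDivergence π hS₁ hS₂ hρ (X ω i) ∂ν) / ENNReal.ofReal (Real.log 2) := by
  let zip : ((Fin n → Fin N₂ → ℂ) × (Fin n → Matrix (Fin N₁) (Fin M) ℂ) ×
      (Fin n → Matrix (Fin N₂) (Fin M) ℂ)) → Fin n → SideInfo M N₁ N₂ :=
    fun v i => (v.1 i, v.2.1 i, v.2.2 i)
  have hzip : Measurable zip := by fun_prop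
  -- The product of the single-use reference kernels, independent of the input law.
  let Q := (piKernel (Fin n) (estimatorKernel M hS₁ hS₂ hρ)).comap zip hzip
  let κ := (piKernel (Fin n) (outputKernel M N₂ hS₁)).comap
    (fun p : _ × (Fin n → Fin M → ℂ) => fun i => (zip p.1 i, p.2 i)) (by fun_prop)
  have hkl : ∀ p, klDiv (κ p) (Q p.1) =
      ∑ i, klDiv (outputKernel M N₂ hS₁ (zip p.1 i, p.2 i))
        (estimatorKernel M hS₁ hS₂ hρ (zip p.1 i)) := fun p =>
    klDiv_pi_outputKernel hS₁ hS₂ hρ (zip p.1) p.2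
  -- Absolute continuity of the products is read off from the finiteness of their divergence, a
  -- finite sum of finite terms.
  have hac : ∀ p, κ p ≪ Q p.1 := fun p => by
    have : klDiv (κ p) (Q p.1) ≠ ∞ := by
      rw [hkl, ENNReal.sum_ne_top]
      exact fun i _ => klDiv_outputKernel_ne_top hS₁ hS₂ hρ (zip p.1 i, p.2 i)
    exact (klDiv_ne_top_iff.mp this).1
  have hmem := fun {f} => lintegral_memoryless (f := f) π hX hY hZ hA hB hS₁ hcond
  have hκ : (ν.map fun ω => (((Z ω, A ω, B ω), X ω), Y ω)) =
      (ν.map fun ω => ((Z ω, A ω, B ω), X ω)) ⊗ₘ κ := by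
    refine Measure.ext_of_lintegral _ fun f hf => ?_
    have hfκ := hf.lintegral_kernel_prod_right' (κ := κ)
    rw [Measure.lintegral_compProd hf, lintegral_map hf (by fun_prop),
      lintegral_map hfκ (by fun_prop)]
    refine (hmem hf).trans (Eq.trans ?_ (hmem (hfκ.comp measurable_fst)).symm)
    refine lintegral_congr fun x => lintegral_congr fun v => ?_
    simp only [Function.comp_apply, lintegral_const, measure_univ, mul_one]
    rfl
  refine (condMutualInfo_le_lintegral hY.aemeasurable hX.aemeasurable (by fun_prop) Q κ hκ
    hac).trans (le_of_eq ?_)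
  have mkl : Measurable fun p => klDiv (κ p) (Q p.1) := by
    simp_rw [hkl]
    exact Finset.measurable_sum _ fun i _ => (measurable_klDiv_outputKernel hS₁ hS₂ hρ).comp
      (by fun_prop : Measurable fun p : _ × (Fin n → Fin M → ℂ) => (zip p.1 i, p.2 i))
  have mm := measurable_meanDivergence π hS₁ hS₂ hρ
  congr 1
  rw [lintegral_map mkl (by fun_prop)]
  refine (hmem (mkl.comp measurable_fst)).trans (Eq.trans ?_
    ((lintegral_map (f := fun x : Fin n → Fin M → ℂ => ∑ i, meanDivergence π hS₁ hS₂ hρ (x i))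
      (Finset.measurable_sum _ fun i _ => mm.comp (measurable_pi_apply i)) hX).trans
    (lintegral_finsetSum _ fun i _ => mm.comp (by fun_prop : Measurable fun ω => X ω i))))
  refine lintegral_congr fun x => ?_
  rw [← lintegral_klDiv_sideLaw]
  refine lintegral_congr fun v => ?_
  simp only [Function.comp_apply, lintegral_const, measure_univ, mul_one]
  rfl

end BlockUse

/-! ### Transfer from the given variables to the canonical laws, and the theorem. -/

section Channel

theorem lintegral_comp_eq_add_mul {Ω : Type*} [MeasurableSpace Ω] {μ : Measure Ω}
    [IsProbabilityMeasure μ] {M : ℕ} {D : (Fin M → ℂ) → ℝ≥0∞} {c φ : ℝ≥0∞}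
    (hD : ∀ x, D x = c + φ * ∑ k, ‖x k‖ₑ ^ 2) {X : Ω → Fin M → ℂ} (hX : Measurable X) :
    ∫⁻ ω, D (X ω) ∂μ = c + φ * ∫⁻ ω, ∑ k, ‖X ω k‖ₑ ^ 2 ∂μ := by
  simp_rw [hD]
  rw [lintegral_add_left measurable_const, lintegral_const, measure_univ, mul_one,
    lintegral_const_mul _ (by fun_prop)]

variable {Ω : Type*} [MeasurableSpace Ω] {μ : Measure Ω} [IsProbabilityMeasure μ] {M N₁ N₂ : ℕ}
  {A : Ω → Matrix (Fin N₁) (Fin M) ℂ} {B : Ω → Matrix (Fin N₂) (Fin M) ℂ}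
  {n₁ : Ω → Fin N₁ → ℂ} {n₂ : Ω → Fin N₂ → ℂ}
  {S₁ : Matrix (Fin N₁) (Fin N₁) ℂ} {S₂ : Matrix (Fin N₂) (Fin N₂) ℂ}

theorem map_fading_noise (hA : Measurable A) (hB : Measurable B)
    (hn₁ : HasLaw n₁ (complexGaussian S₁) μ) (hn₂ : HasLaw n₂ (complexGaussian S₂) μ)
    (hnoise : IndepFun n₁ n₂ μ)
    (hfading : IndepFun (fun ω => (A ω, B ω)) (fun ω => (n₁ ω, n₂ ω)) μ) :
    μ.map (fun ω => ((A ω, B ω), (n₁ ω, n₂ ω))) =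
      fadingNoiseLaw (μ.map fun ω => (A ω, B ω)) S₁ S₂ := by
  rw [(indepFun_iff_map_prod_eq_prod_map_map (hA.prodMk hB).aemeasurable
    (hn₁.aemeasurable.prodMk hn₂.aemeasurable)).mp hfading,
    (indepFun_iff_map_prod_eq_prod_map_map hn₁.aemeasurable hn₂.aemeasurable).mp hnoise,
    hn₁.map_eq, hn₂.map_eq, fadingNoiseLaw]

theorem channelLaw_eq_outputLaw (hA : Measurable A) (hB : Measurable B)
    (hn₁ : HasLaw n₁ (complexGaussian S₁) μ) (hn₂ : HasLaw n₂ (complexGaussian S₂) μ)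
    (hnoise : IndepFun n₁ n₂ μ)
    (hfading : IndepFun (fun ω => (A ω, B ω)) (fun ω => (n₁ ω, n₂ ω)) μ) (x : Fin M → ℂ) :
    channelLaw μ A B n₁ n₂ x = outputLaw (μ.map fun ω => (A ω, B ω)) S₁ S₂ x := by
  rw [outputLaw, ← map_fading_noise hA hB hn₁ hn₂ hnoise hfading,
    AEMeasurable.map_map_of_aemeasurable (Measurable.aemeasurable (by fun_prop))
      ((hA.prodMk hB).aemeasurable.prodMk (hn₁.aemeasurable.prodMk hn₂.aemeasurable))]
  rfl

end Channel

theorem lemma4 {Ω : Type u} [MeasurableSpace Ω] (μ : Measure Ω) [IsProbabilityMeasure μ]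
    {M N₁ N₂ : ℕ}
    -- the fading matrices, the noise vectors, and their laws
    (A : Ω → Matrix (Fin N₁) (Fin M) ℂ) (B : Ω → Matrix (Fin N₂) (Fin M) ℂ)
    (n₁ : Ω → Fin N₁ → ℂ) (n₂ : Ω → Fin N₂ → ℂ)
    (S₁ : Matrix (Fin N₁) (Fin N₁) ℂ) (S₂ : Matrix (Fin N₂) (Fin N₂) ℂ)
    (hS₁ : S₁.PosDef) (hS₂ : S₂.PosDef)
    (hA : Measurable A) (hB : Measurable B)
    (hAB : IsIsotropic μ (fun ω => Matrix.fromRows (A ω) (B ω)))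
    (hn₁ : HasLaw n₁ (complexGaussian S₁) μ) (hn₂ : HasLaw n₂ (complexGaussian S₂) μ)
    (hnoise : IndepFun n₁ n₂ μ)
    (hfading : IndepFun (fun ω => (A ω, B ω)) (fun ω => (n₁ ω, n₂ ω)) μ)
    -- the power constraint and the Gaussian input
    (P : ℝ) (hP : 0 ≤ P)
    (XG : Ω → Fin M → ℂ)
    (hXG : HasLaw XG (complexGaussian (((P / M : ℝ) : ℂ) • 1)) μ)
    (hXGind : IndepFun XG (fun ω => ((A ω, B ω), (n₁ ω, n₂ ω))) μ) :
    let YG := channelOutput A XG n₁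
    let ZG := channelOutput B XG n₂
    let IG : ℝ≥0∞ := condMutualInfo μ YG XG (fun ω => (ZG ω, A ω, B ω))
    let fJ : Ω → ℝ := fun ω => logDetJoint S₁ S₂ (P / M) (A ω) (B ω)
    let fB : Ω → ℝ := fun ω => logDetSide S₁ S₂ (P / M) (B ω)
    -- the Gaussian input maximizes the conditional mutual information
    (∀ X : Ω → Fin M → ℂ, Measurable X →
      IndepFun X (fun ω => ((A ω, B ω), (n₁ ω, n₂ ω))) μ →
      (∫⁻ ω, ∑ i, ‖X ω i‖ₑ ^ 2 ∂μ) ≤ ENNReal.ofReal P →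
      condMutualInfo μ (channelOutput A X n₁) X
        (fun ω => (channelOutput B X n₂ ω, A ω, B ω)) ≤ IG) ∧
    -- the value of the maximum
    (Integrable fB μ → Integrable fJ μ →
      IG = ENNReal.ofReal ((∫ ω, fJ ω ∂μ) - ∫ ω, fB ω ∂μ)) ∧
    (Integrable fB μ → ¬ Integrable fJ μ → IG = ∞) ∧
    (Integrable (fun ω => ∑ i, ∑ j, ‖A ω i j‖ ^ 2) μ →
      Integrable (fun ω => ∑ i, ∑ j, ‖B ω i j‖ ^ 2) μ →
      Integrable fB μ ∧ Integrable fJ μ) ∧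
    -- the bound over `n` uses of the channel
    (∀ (Ω' : Type v) [MeasurableSpace Ω'] (ν : Measure Ω') [IsProbabilityMeasure ν] (n : ℕ)
      (X : Ω' → Fin n → Fin M → ℂ) (Y : Ω' → Fin n → Fin N₁ → ℂ) (Z : Ω' → Fin n → Fin N₂ → ℂ)
      (A' : Ω' → Fin n → Matrix (Fin N₁) (Fin M) ℂ) (B' : Ω' → Fin n → Matrix (Fin N₂) (Fin M) ℂ),
      Measurable X → Measurable Y → Measurable Z → Measurable A' → Measurable B' →
      (∀ᵐ x ∂(ν.map X),
        condDistrib (fun ω (i : Fin n) => (Y ω i, Z ω i, A' ω i, B' ω i)) X ν x =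
          Measure.pi (fun i => channelLaw μ A B n₁ n₂ (x i))) →
      (∑ i, ∫⁻ ω, ∑ k, ‖X ω i k‖ₑ ^ 2 ∂ν) ≤ n * ENNReal.ofReal P →
      condMutualInfo ν Y X (fun ω => (Z ω, A' ω, B' ω)) ≤ n * IG) := by
  intro YG ZG IG fJ fB
  have hρ : 0 ≤ P / M := div_nonneg hP M.cast_nonneg
  have := Measure.isProbabilityMeasure_map (μ := μ) (hA.prodMk hB).aemeasurable
  have hW : AEMeasurable (fun ω => ((A ω, B ω), (n₁ ω, n₂ ω))) μ :=
    (hA.prodMk hB).aemeasurable.prodMk (hn₁.aemeasurable.prodMk hn₂.aemeasurable)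
  have hWlaw := map_fading_noise hA hB hn₁ hn₂ hnoise hfading
  -- The same `c` and `φ` serve all inputs, the Gaussian one, and every time index of the block
  -- bound.
  obtain ⟨c, φ, hD, hDG⟩ := hAB.exists_meanDivergence_eq hS₁ hS₂ hρ hA hB
  have hIG : IG = (∫⁻ x, meanDivergence (μ.map fun ω => (A ω, B ω)) hS₁ hS₂ hρ x
      ∂(complexGaussian (((P / M : ℝ) : ℂ) • (1 : Matrix (Fin M) (Fin M) ℂ)))) /
      ENNReal.ofReal (Real.log 2) := by
    have h := condMutualInfo_gaussian_channel (μ.map fun ω => (A ω, B ω)) hS₁ hS₂ hρ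
      hXG.aemeasurable hW (by
        -- The single-use lemmas need only the product form of the joint law of input, fading and
        -- noise.
        rw [(indepFun_iff_map_prod_eq_prod_map_map hXG.aemeasurable hW).mp hXGind, hWlaw,
          hXG.map_eq])
    exact h
  clear_value IG
  have hIGP : IG = (c + φ * ENNReal.ofReal P) / ENNReal.ofReal (Real.log 2) := by rw [hIG, hDG]
  have hIGJ : IG = ∫⁻ ω, ENNReal.ofReal (fJ ω - fB ω) ∂μ := by
    rw [hIG, lintegral_meanDivergence, lintegral_map (by fun_prop) (hA.prodMk hB)]
    exact lintegral_log_det_errorCov_div hS₁ hS₂ hρ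
  have hle : ∀ ω, fB ω ≤ fJ ω := fun ω => logDetSide_le_logDetJoint hS₁ hS₂ hρ (A ω) (B ω)
  refine ⟨fun X hX hXind hXP => ?_, fun hB1 hJ => ?_, fun hB1 hJ => ?_, fun hA2 hB2 => ?_, ?_⟩
  · have := Measure.isProbabilityMeasure_map (μ := μ) hX.aemeasurable
    have h := condMutualInfo_channel_le (μ.map X) (μ.map fun ω => (A ω, B ω)) hS₁ hS₂ hρ
      hX.aemeasurable hW (by
        rw [(indepFun_iff_map_prod_eq_prod_map_map hX.aemeasurable hW).mp hXind, hWlaw])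
    rw [lintegral_map (measurable_meanDivergence _ hS₁ hS₂ hρ) hX,
      lintegral_comp_eq_add_mul hD hX] at h
    rw [hIGP]
    exact h.trans (ENNReal.div_le_div_right (add_le_add_right (mul_le_mul_right hXP φ) c) _)
  · rw [hIGJ, lintegral_ofReal_sub_eq_ofReal hJ hB1 hle]
  · rw [hIGJ, lintegral_ofReal_sub_eq_top (measurable_logDetJoint hS₁ hS₂ hρ hA hB) hB1 hle hJ]
  · exact ⟨integrable_logDetSide hS₁ hS₂ hρ hB hB2, integrable_logDetJoint hS₁ hS₂ hρ hA hB hA2 hB2⟩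
  · intro Ω' _ ν _ n X Y Z A' B' hX hY hZ hA' hB' hcond hXP
    simp_rw [channelLaw_eq_outputLaw hA hB hn₁ hn₂ hnoise hfading] at hcond
    refine (condMutualInfo_memoryless_le _ hX hY hZ hA' hB' hS₁ hS₂ hρ hcond).trans ?_
    rw [hIGP, ← mul_div_assoc]
    refine ENNReal.div_le_div_right ?_ _
    have h : ∀ i, ∫⁻ ω, meanDivergence (μ.map fun ω => (A ω, B ω)) hS₁ hS₂ hρ (X ω i) ∂ν =
        c + φ * ∫⁻ ω, ∑ k, ‖X ω i k‖ₑ ^ 2 ∂ν := fun i =>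
      lintegral_comp_eq_add_mul hD ((measurable_pi_apply i).comp hX)
    -- Summing over the uses gives `n c` plus `φ` times the total power, so only the average power
    -- constraint is needed.
    rw [Finset.sum_congr rfl fun i _ => h i, Finset.sum_add_distrib, ← Finset.mul_sum,
      Finset.sum_const,
      Finset.card_univ, Fintype.card_fin, nsmul_eq_mul, mul_add, mul_left_comm]
    exact add_le_add_right (mul_le_mul_right hXP φ) _
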